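/- Let $v_1,v_2,v_3\in\mathbb R^2$ be distinct and non-collinear, let $\Delta=\mathrm{co}\{v_1,v_2,v_3\}$ be the triangle they span, and let $c$ be its circumcenter, i.e. the unique point with $|v_1-c|=|v_2-c|=|v_3-c|$. Let $\varphi(y)=\min_{i}v_i\cdot y$ be the initial velocity potential. For $t>0$ let $u_t(x)=\inf_y\big(\frac{|x-y|^2}{2t}+\varphi(y)\big)$ (a concave function), with differential $\partial u_t(x)=\{q\in\mathbb R^2:\ u_t(z)\le u_t(x)+q\cdot(z-x)\ \text{for all }z\}$. For $t\ge0$ let $\psi_t(y)=\frac12|y|^2+t\varphi(y)$, and let $T_t=\nabla\psi_t^{**}$ be the convexified transport map, where $\psi_t^{**}$ is the second Legendre transform of $\psi_t$. For $\varepsilon>0$ let $u^\varepsilon_t(x)=-\varepsilon\log\Big(\frac1{2\pi\varepsilon t}\int_{\mathbb R^2}\exp\big(-\frac{|x-y|^2}{2\varepsilon t}-\frac{\varphi(y)}{\varepsilon}\big)\,dy\Big)$ be the solution of $\partial_tu^\varepsilon+\frac12|\nabla u^\varepsilon|^2=\frac\varepsilon2\Delta u^\varepsilon$, $u^\varepsilon_0=\varphi$,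 and let $X^\varepsilon$ be the flow $\partial_tX^\varepsilon_t(y)=\nabla u^\varepsilon_t(X^\varepsilon_t(y))$ for $t>0$, with $t\mapsto X^\varepsilon_t(y)$ continuous on $[0,\infty)$ and $X^\varepsilon_0(y)=y$. Let $X_t(y)=\lim_{\varepsilon\to0^+}X^\varepsilon_t(y)$ for $t\ge 0$ be the Lagrangian flow of the adhesion model. (The flows $X^\varepsilon$ and their limit $X$ exist.) For $t>0$ and $x\in\mathbb R^2$ define the transport velocity $$V_t(x)=\begin{cases}v_i & \text{if } |x-tv_i|>|x-tv_j|\ \text{for all }j\ne i,\\ \tfrac12(v_i+v_j) & \text{if } v_i\cdot(x-tc)=v_j\cdot(x-tc)<v_k\cdot(x-tc),\ \{i,j,k\}=\{1,2,3\},\\ c & \text{if } x=tc.\end{cases}$$ Then the following are equivalent: (i) $c\in\Delta$. (ii) $V_t(x)\in\partial u_t(x)$ for all $t>0$ and all $x\in\mathbb R^2$. (iii) $T_t(y)=X_t(y)$ for all $t\ge0$ and all $y\in\mathbb R^2$. (iv) The maps $T_t$ are sticky: whenever $0\le s\le t$ and $T_s(y)=T_s(z)$, also $T_t(y)=T_t(z)$.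 (v) For every $t>0$, $V_t$ satisfies a one-sided Lipschitz condition: there is $\lambda\ge0$ with $(V_t(x)-V_t(z))\cdot(x-z)\le\lambda|x-z|^2$ for all $x,z\in\mathbb R^2$. -/

import Mathlib

namespace ThreeSector

/-- The Euclidean plane. -/
abbrev Plane : Type := EuclideanSpace ℝ (Fin 2)

/-! Potentials. -/

/-- The initial velocity potential `φ(y) = min_i v_i · y`. -/
noncomputable def phi (v : Fin 3 → Plane) (y : Plane) : ℝ :=
  ⨅ i : Fin 3, inner ℝ (v i) y

/-- The velocity potential `u_t` of the inviscid problem (Hopf-Lax formula), for `t > 0`. -/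
noncomputable def u (v : Fin 3 → Plane) (t : ℝ) (x : Plane) : ℝ :=
  ⨅ y : Plane, (‖x - y‖ ^ 2 / (2 * t) + phi v y)

/-- The free-streaming potential `ψ_t(y) = |y|²/2 + t φ(y)`. -/
noncomputable def psi (v : Fin 3 → Plane) (t : ℝ) (y : Plane) : ℝ :=
  ‖y‖ ^ 2 / 2 + t * phi v y

/-- The Legendre transform `f*(x) = sup_y (x · y - f(y))`. It is applied below only to continuous
functions of superlinear growth, for which the supremum is finite. -/
noncomputable def legendre (f : Plane → ℝ) (x : Plane) : ℝ :=
  ⨆ y : Plane, (inner ℝ x y - f y)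

/-- The convexified transport map `T_t = ∇ψ_t**`. -/
noncomputable def T (v : Fin 3 → Plane) (t : ℝ) (y : Plane) : Plane :=
  gradient (legendre (legendre (psi v t))) y

/-- The differential at `x` of a `lam`-concave function `f`: the slopes at `x` of the paraboloids
with Hessian `lam • I` that touch the graph of `f` at `x` from above. -/
def differential (lam : ℝ) (f : Plane → ℝ) (x : Plane) : Set Plane :=
  {q | ∀ z, f z ≤ f x + inner ℝ q (z - x) + lam / 2 * ‖z - x‖ ^ 2}

/-! The Lagrangian flow of the adhesion model, as a zero-viscosity limit. -/

/-- The viscous velocity potential `u^ε_t` (Cole-Hopf formula in dimension two): the solution of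
`∂_t u + |∇u|²/2 = (ε/2) Δu` with initial data `φ`. -/
noncomputable def uVisc (v : Fin 3 → Plane) (ε t : ℝ) (x : Plane) : ℝ :=
  -ε * Real.log ((2 * Real.pi * ε * t)⁻¹ *
    ∫ y : Plane, Real.exp (-(‖x - y‖ ^ 2) / (2 * ε * t) - phi v y / ε))

/-- `Y t y` is the flow of the viscous velocity field `v^ε = ∇u^ε`: `∂_t Y = v^ε(Y, t)` for
`t > 0`, and each path is continuous on `[0, ∞)` with `Y 0 y = y`. -/
def IsViscousFlow (v : Fin 3 → Plane) (ε : ℝ) (Y : ℝ → Plane → Plane) : Prop :=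
  ∀ y : Plane, Y 0 y = y ∧ ContinuousOn (fun t => Y t y) (Set.Ici 0) ∧
    ∀ t : ℝ, 0 < t → HasDerivAt (fun s => Y s y) (gradient (uVisc v ε t) (Y t y)) t

/-- `X t y` (`t ≥ 0`) is the limit, as `ε → 0+`, of the flows of the viscous velocity fields. -/
def IsLagrangianFlow (v : Fin 3 → Plane) (X : ℝ → Plane → Plane) : Prop :=
  ∃ Y : ℝ → ℝ → Plane → Plane, (∀ ε : ℝ, 0 < ε → IsViscousFlow v ε (Y ε)) ∧
    ∀ t : ℝ, 0 ≤ t → ∀ y : Plane,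
      Filter.Tendsto (fun ε => Y ε t y) (nhdsWithin 0 (Set.Ioi 0)) (nhds (X t y))

/-! The transport velocity. -/

/-- The circumcenter of the triangle with vertices `v_i`. -/
noncomputable def center (v : Fin 3 → Plane) (hv : AffineIndependent ℝ v) : Plane :=
  (⟨v, hv⟩ : Affine.Simplex ℝ Plane 2).circumcenter

/-- The open sector `A_i^t` on which `|x - t v_i|²` is the largest of the three. -/
def sector (v : Fin 3 → Plane) (t : ℝ) (i : Fin 3) : Set Plane :=
  {x | ∀ j, j ≠ i → ‖x - t • v j‖ ^ 2 < ‖x - t • v i‖ ^ 2}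

/-- The ray `R_ij^0` along which `v_i · y = v_j · y < v_k · y` for the third index `k`. -/
def ray (v : Fin 3 → Plane) (i j : Fin 3) : Set Plane :=
  {y | inner ℝ (v i) y = inner ℝ (v j) y ∧
    ∀ k, k ≠ i → k ≠ j → inner ℝ (v i) y < inner ℝ (v k) y}

/-- The shifted ray `R_ij^t = R_ij^0 + t c`. -/
def rayAt (v : Fin 3 → Plane) (c : Plane) (t : ℝ) (i j : Fin 3) : Set Plane :=
  {x | x - t • c ∈ ray v i j}

open Classical in
/-- The transport velocity `V_t`, with `c` the circumcenter: it is `v_i` on the sector `A_i^t`,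
`(v_i + v_j)/2` on the ray `R_ij^t`, and `c` at the one remaining point `x = t c`. -/
noncomputable def V (v : Fin 3 → Plane) (c : Plane) (t : ℝ) (x : Plane) : Plane :=
  if x ∈ sector v t 0 then v 0
  else if x ∈ sector v t 1 then v 1
  else if x ∈ sector v t 2 then v 2
  else if x ∈ rayAt v c t 0 1 then midpoint ℝ (v 0) (v 1)
  else if x ∈ rayAt v c t 1 2 then midpoint ℝ (v 1) (v 2)
  else if x ∈ rayAt v c t 2 0 then midpoint ℝ (v 2) (v 0)
  else c

/-- A family of maps `T_t` (`t ≥ 0`) is sticky: points that have met never separate. -/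
def IsSticky (F : ℝ → Plane → Plane) : Prop :=
  ∀ s t : ℝ, 0 ≤ s → s ≤ t → ∀ y z : Plane, F s y = F s z → F t y = F t z

/-- The one-sided Lipschitz condition for a vector field on the plane. -/
def OneSidedLipschitz (W : Plane → Plane) : Prop :=
  ∃ lam : ℝ, 0 ≤ lam ∧ ∀ x z : Plane, inner ℝ (W x - W z) (x - z) ≤ lam * ‖x - z‖ ^ 2

end ThreeSector

namespace ThreeSector

open Set Filter Topology MeasureTheory

/-! ### The initial potential and the triangle -/

/-! Since |v_i - c| does not depend on i, v_i · x - t|v_i|²/2 equals v_i · (x - tc) plus a multiple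
of t common to all i. Hence `u v t` is φ translated by tc, up to a constant (`u_eq`), and every
point of the face of the triangle that minimizes the direction w = x - tc is a supergradient at x.
Away from x = tc the transport velocity lies in this face; at x = tc the face is the whole triangle
and the velocity is c. Membership of c in the triangle is thus exactly what makes V a selection of
supergradients. Such a selection of a concave function is dissipative, and conversely the one-sided
Lipschitz bound between tc + ry and tc forces φ(y) ≤ c · y as r → 0, so that c is in the triangle by
separation.

The same translation gives T_t y = y + tq, where for t > 0 the point q of the triangle minimizes the
direction w = y + t(q - c) (`T_eq`). If c is in the triangle, the face minimizing w contains a point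
m with m - c orthogonal to the face (`exists_face_velocity`). Moving w along m - c keeps that face
minimal for a short time, so T moves with velocity m and solves the inclusion Z' ∈ ∂u_t(Z).

The viscous potentials are concave and lie within ε log 3 of u. Comparing supergradients of two
uniformly close concave functions (`norm_sub_sq_le_of_supergradient`) shows that viscous paths
converge, that they contract distances, and that any solution of the inclusion is their limit. This
yields T = X, and X is sticky by contraction.

Conversely, all points c - p with p in the triangle meet at c at time one. If they stay together,
every vertex has the same component along q - c, where q is the projection of c; hence q = c. -/

lemma phi_le (v : Fin 3 → Plane) (y : Plane) (i : Fin 3) : phi v y ≤ inner ℝ (v i) y :=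
  ciInf_le (Set.finite_range _).bddBelow i

lemma exists_phi_eq (v : Fin 3 → Plane) (y : Plane) : ∃ i, phi v y = inner ℝ (v i) y := by
  obtain ⟨i, hi⟩ := exists_eq_ciInf_of_finite (f := fun i : Fin 3 => inner ℝ (v i) y)
  exact ⟨i, hi.symm⟩

lemma le_phi {v : Fin 3 → Plane} {y : Plane} {a : ℝ} (h : ∀ i, a ≤ inner ℝ (v i) y) :
    a ≤ phi v y :=
  le_ciInf h

lemma phi_eq_of_forall_le {v : Fin 3 → Plane} {y : Plane} {i : Fin 3}
    (h : ∀ j, inner ℝ (v i) y ≤ (inner ℝ (v j) y : ℝ)) : phi v y = inner ℝ (v i) y :=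
  le_antisymm (phi_le v y i) (le_phi h)

lemma phi_zero (v : Fin 3 → Plane) : phi v 0 = 0 := by
  simp [phi]

lemma phi_smul (v : Fin 3 → Plane) {r : ℝ} (hr : 0 ≤ r) (y : Plane) :
    phi v (r • y) = r * phi v y := by
  simp only [phi, inner_smul_right]
  exact (Real.mul_iInf_of_nonneg hr _).symm

lemma exists_weights_of_mem_convexHull {v : Fin 3 → Plane} {q : Plane}
    (hq : q ∈ convexHull ℝ (range v)) :
    ∃ a : Fin 3 → ℝ, (∀ i, 0 ≤ a i) ∧ ∑ i, a i = 1 ∧ ∑ i, a i • v i = q := by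
  have h : convexHull ℝ (range v) ⊆
      {q | ∃ a : Fin 3 → ℝ, (∀ i, 0 ≤ a i) ∧ ∑ i, a i = 1 ∧ ∑ i, a i • v i = q} := by
    refine convexHull_min ?_ ?_
    · rintro _ ⟨i, rfl⟩
      exact ⟨Pi.single i 1, fun j => by rw [Pi.single_apply]; split_ifs <;> simp, by simp,
        by simp [Pi.single_apply]⟩
    · rintro _ ⟨a, ha, ha1, rfl⟩ _ ⟨b, hb, hb1, rfl⟩ r s hr hs hrs
      refine ⟨fun i => r * a i + s * b i, fun i => by have := ha i; have := hb i; positivity,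
        ?_, ?_⟩
      · rw [Finset.sum_add_distrib, ← Finset.mul_sum, ← Finset.mul_sum, ha1, hb1]
        simpa using hrs
      · simp only [add_smul, mul_smul, Finset.sum_add_distrib, Finset.smul_sum]
  exact h hq

lemma vertex_mem (v : Fin 3 → Plane) (i : Fin 3) : v i ∈ convexHull ℝ (range v) :=
  subset_convexHull ℝ _ (mem_range_self i)

lemma le_inner_of_mem_convexHull {v : Fin 3 → Plane} {q w : Plane} {a : ℝ}
    (hq : q ∈ convexHull ℝ (range v)) (h : ∀ i, a ≤ inner ℝ (v i) w) : a ≤ inner ℝ q w := by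
  obtain ⟨b, hb, hb1, rfl⟩ := exists_weights_of_mem_convexHull hq
  rw [sum_inner]
  calc a = ∑ i, b i * a := by rw [← Finset.sum_mul, hb1, one_mul]
    _ ≤ ∑ i, inner ℝ (b i • v i) w := Finset.sum_le_sum fun i _ => by
      rw [real_inner_smul_left]; exact mul_le_mul_of_nonneg_left (h i) (hb i)

lemma phi_le_inner {v : Fin 3 → Plane} {q : Plane} (hq : q ∈ convexHull ℝ (range v))
    (w : Plane) : phi v w ≤ inner ℝ q w :=
  le_inner_of_mem_convexHull hq (phi_le v w)

/-- A point of the triangle on the supporting line in direction `w` is a supergradient of `φ`. -/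
lemma phi_le_phi_add {v : Fin 3 → Plane} {q w : Plane} (hq : q ∈ convexHull ℝ (range v))
    (hqw : inner ℝ q w = phi v w) (z : Plane) : phi v z ≤ phi v w + inner ℝ q (z - w) := by
  rw [inner_sub_right, hqw]
  linarith [phi_le_inner hq z]

lemma exists_projection (v : Fin 3 → Plane) (p : Plane) :
    ∃ q ∈ convexHull ℝ (range v), ∀ k ∈ convexHull ℝ (range v), 0 ≤ inner ℝ (q - p) (k - q) := by
  have hc : Convex ℝ (convexHull ℝ (range v)) := convex_convexHull ℝ _
  obtain ⟨q, hq, h⟩ := exists_norm_eq_iInf_of_complete_convex ⟨_, vertex_mem v 0⟩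
    ((Set.finite_range v).isCompact_convexHull ℝ).isComplete hc p
  refine ⟨q, hq, fun k hk => ?_⟩
  have := (norm_eq_iInf_iff_real_inner_le_zero hc hq).1 h k hk
  rw [← neg_sub p q, inner_neg_left]
  linarith

/-- Separation: with q the projection of c, the direction q - c is tested, and q · (q - c) ≤ φ(q -
c) ≤ c · (q - c) forces q = c. -/
lemma mem_convexHull_of_phi_le {v : Fin 3 → Plane} {c : Plane}
    (h : ∀ y, phi v y ≤ inner ℝ c y) : c ∈ convexHull ℝ (range v) := by
  obtain ⟨q, hq, hk⟩ := exists_projection v c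
  have h1 : inner ℝ q (q - c) ≤ phi v (q - c) := le_phi fun i => by
    have := hk _ (vertex_mem v i)
    rw [real_inner_comm, inner_sub_left] at this
    linarith
  have h2 := h1.trans (h (q - c))
  have h3 : inner ℝ (q - c) (q - c) ≤ (0 : ℝ) := by
    rw [inner_sub_left]; linarith
  rw [real_inner_self_nonpos, sub_eq_zero] at h3
  exact h3 ▸ hq

/-- The edge vectors of a nondegenerate triangle span the plane, and w is orthogonal to all of them.
-/
lemma eq_zero_of_inner_eq {v : Fin 3 → Plane} (hv : AffineIndependent ℝ v) {w : Plane}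
    (h : ∀ i, inner ℝ (v i) w = (inner ℝ (v 0) w : ℝ)) : w = 0 := by
  have htop : affineSpan ℝ (range v) = ⊤ :=
    hv.affineSpan_eq_top_iff_card_eq_finrank_add_one.2 (by simp)
  have h2 : vectorSpan ℝ (range v) = ⊤ := by
    rw [← direction_affineSpan, htop, AffineSubspace.direction_top]
  rw [vectorSpan_range_eq_span_range_vsub_right ℝ v 0] at h2
  have hw : w ∈ Submodule.span ℝ (range fun i => v i -ᵥ v 0) := h2 ▸ Submodule.mem_top
  have h3 : ∀ x ∈ Submodule.span ℝ (range fun i => v i -ᵥ v 0), inner ℝ x w = (0 : ℝ) := by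
    intro x hx
    induction hx using Submodule.span_induction with
    | mem x hx =>
      obtain ⟨i, rfl⟩ := hx
      simp only [vsub_eq_sub, inner_sub_left, h i, sub_self]
    | zero => simp
    | add x y _ _ hx hy => rw [inner_add_left, hx, hy, add_zero]
    | smul a x _ hx => rw [real_inner_smul_left, hx, mul_zero]
  exact inner_self_eq_zero.1 (h3 w hw)

/-- At each point, the minimum in `φ` is attained once, twice, or the point is the origin. -/
lemma phi_cases {v : Fin 3 → Plane} (hv : AffineIndependent ℝ v) (w : Plane) :
    w = 0 ∨ (∃ i, ∀ j, j ≠ i → inner ℝ (v i) w < (inner ℝ (v j) w : ℝ)) ∨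
      ∃ i j, i ≠ j ∧ w ∈ ray v i j := by
  obtain ⟨i, hi⟩ := exists_phi_eq v w
  have hle : ∀ j, inner ℝ (v i) w ≤ (inner ℝ (v j) w : ℝ) := fun j => hi ▸ phi_le v w j
  by_cases h1 : ∀ j, j ≠ i → inner ℝ (v i) w < (inner ℝ (v j) w : ℝ)
  · exact Or.inr (Or.inl ⟨i, h1⟩)
  push Not at h1
  obtain ⟨j, hji, hj⟩ := h1
  by_cases h2 : ∀ k, k ≠ i → k ≠ j → inner ℝ (v i) w < (inner ℝ (v k) w : ℝ)
  · exact Or.inr (Or.inr ⟨i, j, hji.symm, le_antisymm (hle j) hj, h2⟩)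
  push Not at h2
  obtain ⟨k, hki, hkj, hk⟩ := h2
  refine Or.inl (eq_zero_of_inner_eq hv fun l => ?_)
  have hall : ∀ l, inner ℝ (v l) w = (inner ℝ (v i) w : ℝ) := by
    intro l
    have : l = i ∨ l = j ∨ l = k := by omega
    rcases this with rfl | rfl | rfl
    · rfl
    · exact le_antisymm hj (hle _)
    · exact le_antisymm hk (hle _)
  rw [hall l, hall 0]

lemma inner_midpoint_sub {a b c : Plane} (h : ‖a - c‖ = ‖b - c‖) :
    inner ℝ (midpoint ℝ a b - c) (a - b) = (0 : ℝ) := by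
  have h1 : midpoint ℝ a b - c = (2⁻¹ : ℝ) • ((a - c) + (b - c)) := by
    rw [midpoint_eq_smul_add, invOf_eq_inv]; module
  have h2 : a - b = (a - c) - (b - c) := by abel
  rw [h1, h2, real_inner_smul_left, real_inner_add_sub_eq_zero_iff _ _ |>.2 h, mul_zero]

/-- The zero-viscosity velocity at `w`: it lies in the face of the triangle that minimizes
`w`, and its difference to the circumcenter is orthogonal to that face. -/
lemma exists_face_velocity {v : Fin 3 → Plane} (hv : AffineIndependent ℝ v) {c : Plane}
    (hc : ∀ i j, ‖v i - c‖ = ‖v j - c‖) (hcv : c ∈ convexHull ℝ (range v)) {w q : Plane}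
    (hq : q ∈ convexHull ℝ (range v)) (hqw : inner ℝ q w = phi v w) :
    ∃ m ∈ convexHull ℝ (range v), inner ℝ m w = phi v w ∧
      ∀ k, inner ℝ (v k) w = phi v w →
        inner ℝ (m - c) (v k - q) = (0 : ℝ) ∧ inner ℝ (m - c) (v k - m) = (0 : ℝ) := by
  obtain ⟨a, ha, ha1, haq⟩ := exists_weights_of_mem_convexHull hq
  -- Complementary slackness: q attains the minimum, so it puts no weight on vertices outside the
  -- minimizing face.
  have hzero : ∀ k, phi v w < inner ℝ (v k) w → a k = 0 := by
    have hs : ∑ k, a k * (inner ℝ (v k) w - phi v w) = 0 := by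
      simp only [mul_sub, Finset.sum_sub_distrib, ← Finset.sum_mul, ha1, one_mul]
      rw [← hqw, ← haq, sum_inner, sub_eq_zero]
      exact Finset.sum_congr rfl fun i _ => (real_inner_smul_left _ _ _).symm
    rw [Finset.sum_eq_zero_iff_of_nonneg fun k _ =>
      mul_nonneg (ha k) (sub_nonneg.2 (phi_le v w k))] at hs
    intro k hk
    rcases mul_eq_zero.1 (hs k (Finset.mem_univ k)) with h | h
    · exact h
    · linarith
  rcases phi_cases hv w with rfl | ⟨i, hi⟩ | ⟨i, j, hij, hr, hk⟩
  -- For w = 0 the face is the whole triangle and m = c; only this case uses that c lies in the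
  -- triangle.
  · exact ⟨c, hcv, by simp [phi_zero], fun k _ => by simp⟩
  · have hphi : phi v w = inner ℝ (v i) w := phi_eq_of_forall_le fun j => by
      rcases eq_or_ne j i with rfl | h
      · rfl
      · exact (hi j h).le
    have hz : ∀ k, k ≠ i → a k = 0 := fun k hki => hzero k (hphi ▸ hi k hki)
    have hai : a i = 1 := by
      rw [← ha1, Finset.sum_eq_single i (fun k _ h => hz k h) (by simp)]
    have hqi : q = v i := by
      rw [← haq, Finset.sum_eq_single i (fun k _ h => by rw [hz k h, zero_smul]) (by simp), hai,
        one_smul]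
    refine ⟨v i, vertex_mem v i, hphi.symm, fun k hk => ?_⟩
    have : k = i := by
      by_contra h
      exact absurd hk (hphi ▸ (hi k h).ne')
    subst this
    simp [hqi]
  · have hphi : phi v w = inner ℝ (v i) w := phi_eq_of_forall_le fun l => by
      rcases eq_or_ne l i with rfl | h
      · rfl
      rcases eq_or_ne l j with rfl | h'
      · exact hr.le
      · exact (hk l h h').le
    have hz : ∀ k, k ∉ ({i, j} : Finset (Fin 3)) → a k = 0 := fun k hkk => by
      simp only [Finset.mem_insert, Finset.mem_singleton, not_or] at hkk
      exact hzero k (hphi ▸ hk k hkk.1 hkk.2)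
    have hsum : a i + a j = 1 := by
      rw [← ha1, ← Finset.sum_pair hij]
      exact Finset.sum_subset (Finset.subset_univ _) fun k _ h => hz k h
    have hqe : q = a i • v i + a j • v j := by
      rw [← haq, ← Finset.sum_pair (f := fun k => a k • v k) hij]
      exact (Finset.sum_subset (Finset.subset_univ _)
        fun k _ h => by rw [hz k h, zero_smul]).symm
    have hm : midpoint ℝ (v i) (v j) = (2⁻¹ : ℝ) • v i + (2⁻¹ : ℝ) • v j := by
      rw [midpoint_eq_smul_add, invOf_eq_inv, smul_add]
    have ho := inner_midpoint_sub (hc i j)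
    refine ⟨midpoint ℝ (v i) (v j),
      (convex_convexHull ℝ _).midpoint_mem (vertex_mem v i) (vertex_mem v j), ?_, ?_⟩
    · rw [hm, inner_add_left, real_inner_smul_left, real_inner_smul_left, ← hr, hphi]; ring
    · intro k hkp
      have hkij : k = i ∨ k = j := by
        by_contra h
        push Not at h
        exact absurd hkp (hphi ▸ (hk k h.1 h.2).ne')
      -- Points on the line through the edge differ by multiples of v_i - v_j, and the midpoint
      -- minus c lies on the perpendicular bisector's direction.
      have key : ∀ b : ℝ, ∀ p, p = (1 - b) • v i + b • v j → ∀ b' : ℝ, ∀ p',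
          p' = (1 - b') • v i + b' • v j →
          inner ℝ (midpoint ℝ (v i) (v j) - c) (p - p') = (0 : ℝ) := by
        rintro b p rfl b' p' rfl
        have : (1 - b) • v i + b • v j - ((1 - b') • v i + b' • v j) =
          (b' - b) • (v i - v j) := by module
        rw [this, inner_smul_right, ho, mul_zero]
      have hk' : ∃ b : ℝ, v k = (1 - b) • v i + b • v j := by
        rcases hkij with rfl | rfl
        · exact ⟨0, by module⟩
        · exact ⟨1, by module⟩
      obtain ⟨b, hb⟩ := hk'
      refine ⟨key b _ hb (a j) q (by rw [hqe, ← hsum]; module), key b _ hb 2⁻¹ _ ?_⟩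
      rw [hm]; module

/-! ### Supergradients -/

lemma mem_differential_zero {f : Plane → ℝ} {x q : Plane} :
    q ∈ differential 0 f x ↔ ∀ z, f z ≤ f x + inner ℝ q (z - x) := by
  simp [differential]

/-- A continuous selection of supergradients is the gradient. -/
lemma hasGradientAt_of_supergradient {f : Plane → ℝ} {q : Plane → Plane}
    (h : ∀ x z, f z ≤ f x + inner ℝ (q x) (z - x)) {x : Plane} (hq : ContinuousAt q x) :
    HasGradientAt f (q x) x := by
  rw [hasGradientAt_iff_isLittleO, Asymptotics.isLittleO_iff]
  intro e he
  filter_upwards [Metric.continuousAt_iff'.1 hq e he] with z hz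
  have h1 := h x z
  have h2 := h z x
  have h3 : inner ℝ (q z - q x) (z - x) ≥ -(‖q z - q x‖ * ‖z - x‖) :=
    neg_le_of_abs_le (abs_real_inner_le_norm _ _)
  have h4 : ‖q z - q x‖ * ‖z - x‖ ≤ e * ‖z - x‖ :=
    mul_le_mul_of_nonneg_right (by rw [← dist_eq_norm]; exact hz.le) (norm_nonneg _)
  have h5 : inner ℝ (q z) (x - z) = -(inner ℝ (q z) (z - x) : ℝ) := by
    rw [← inner_neg_right, neg_sub]
  rw [inner_sub_left] at h3
  rw [Real.norm_eq_abs, abs_le]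
  constructor <;> linarith

/-- Supergradients of two functions at uniformly bounded distance are almost dissipative. -/
lemma inner_supergradient_sub_le {f g : Plane → ℝ} {p q x z : Plane} {a b : ℝ}
    (hp : p ∈ differential 0 f x) (hq : q ∈ differential 0 g z) (ha : ∀ x, g x - a ≤ f x)
    (hb : ∀ x, f x ≤ g x + b) : inner ℝ (p - q) (x - z) ≤ a + b := by
  have h1 := mem_differential_zero.1 hp z
  have h2 := mem_differential_zero.1 hq x
  have h3 := ha z
  have h4 := hb x
  have h5 : inner ℝ p (z - x) = -(inner ℝ p (x - z) : ℝ) := by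
    rw [← inner_neg_right, neg_sub]
  rw [inner_sub_left]
  linarith

/-! ### The Hopf-Lax formula -/

lemma sq_norm_add_smul (y a : Plane) (t : ℝ) :
    ‖y + t • a‖ ^ 2 = ‖y‖ ^ 2 + 2 * t * inner ℝ a y + t ^ 2 * ‖a‖ ^ 2 := by
  rw [norm_add_sq_real, inner_smul_right, norm_smul, mul_pow, Real.norm_eq_abs, sq_abs,
    real_inner_comm]
  ring

/-- At y, φ agrees with one linear function v_j · y; completing the square shows that this piece is
smallest at x - t v_j, with the value in the hypothesis. -/
lemma le_sq_norm_add_phi {v : Fin 3 → Plane} {t : ℝ} (ht : 0 < t) {x : Plane} {a : ℝ}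
    (h : ∀ i, a ≤ inner ℝ (v i) x - t / 2 * ‖v i‖ ^ 2) (y : Plane) :
    a ≤ ‖x - y‖ ^ 2 / (2 * t) + phi v y := by
  obtain ⟨j, hj⟩ := exists_phi_eq v y
  refine (h j).trans ?_
  have h2 : ‖y - x‖ ^ 2 / (2 * t) + t / 2 * ‖v j‖ ^ 2 + inner ℝ (v j) (y - x) =
      ‖y - x + t • v j‖ ^ 2 / (2 * t) := by
    rw [sq_norm_add_smul]; field_simp; ring
  have h3 : 0 ≤ ‖y - x + t • v j‖ ^ 2 / (2 * t) := by positivity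
  simp only [hj, norm_sub_rev x y]
  rw [inner_sub_right] at h2
  linarith

lemma le_u {v : Fin 3 → Plane} {t : ℝ} (ht : 0 < t) {x : Plane} {a : ℝ}
    (h : ∀ i, a ≤ inner ℝ (v i) x - t / 2 * ‖v i‖ ^ 2) : a ≤ u v t x :=
  le_ciInf (le_sq_norm_add_phi ht h)

lemma u_le (v : Fin 3 → Plane) {t : ℝ} (ht : 0 < t) (x : Plane) (i : Fin 3) :
    u v t x ≤ inner ℝ (v i) x - t / 2 * ‖v i‖ ^ 2 := by
  have hb : BddBelow (range fun y : Plane => ‖x - y‖ ^ 2 / (2 * t) + phi v y) := by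
    refine ⟨⨅ i, ((inner ℝ (v i) x : ℝ) - t / 2 * ‖v i‖ ^ 2), ?_⟩
    rintro _ ⟨y, rfl⟩
    exact le_sq_norm_add_phi ht (fun i => ciInf_le (Set.finite_range _).bddBelow i) y
  refine (ciInf_le hb (x - t • v i)).trans ?_
  have h1 := phi_le v (x - t • v i) i
  rw [inner_sub_right, inner_smul_right, real_inner_self_eq_norm_sq] at h1
  have h2 : ‖x - (x - t • v i)‖ ^ 2 / (2 * t) = t / 2 * ‖v i‖ ^ 2 := by
    rw [sub_sub_cancel, norm_smul, mul_pow, Real.norm_eq_abs, sq_abs]; field_simp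
  simp only [h2]
  linarith

lemma inner_sub_smul_center {v : Fin 3 → Plane} {c : Plane}
    (hc : ∀ i j, ‖v i - c‖ = ‖v j - c‖) (t : ℝ) (x : Plane) (i : Fin 3) :
    inner ℝ (v i) x - t / 2 * ‖v i‖ ^ 2 =
      inner ℝ (v i) (x - t • c) + t * ((‖c‖ ^ 2 - ‖v 0 - c‖ ^ 2) / 2) := by
  rw [hc 0 i, norm_sub_sq_real, inner_sub_right, inner_smul_right]
  ring

/-- The potential `u_t` is `φ` shifted by `t c`, up to a constant. -/
lemma u_eq {v : Fin 3 → Plane} {c : Plane} (hc : ∀ i j, ‖v i - c‖ = ‖v j - c‖) {t : ℝ}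
    (ht : 0 < t) (x : Plane) :
    u v t x = phi v (x - t • c) + t * ((‖c‖ ^ 2 - ‖v 0 - c‖ ^ 2) / 2) := by
  refine le_antisymm ?_ (le_u ht fun i => ?_)
  · rw [← sub_le_iff_le_add]
    refine le_phi fun i => ?_
    have := u_le v ht x i
    rw [inner_sub_smul_center hc] at this
    linarith
  · rw [inner_sub_smul_center hc]
    linarith [phi_le v (x - t • c) i]

lemma mem_differential_u {v : Fin 3 → Plane} {c : Plane} (hc : ∀ i j, ‖v i - c‖ = ‖v j - c‖)
    {t : ℝ} (ht : 0 < t) {x q : Plane} (hq : q ∈ convexHull ℝ (range v))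
    (hqw : inner ℝ q (x - t • c) = phi v (x - t • c)) : q ∈ differential 0 (u v t) x := by
  refine mem_differential_zero.2 fun z => ?_
  rw [u_eq hc ht, u_eq hc ht]
  have := phi_le_phi_add hq hqw (z - t • c)
  rw [sub_sub_sub_cancel_right] at this
  linarith

/-! ### The viscous velocity field -/

/-- A measurable selection of supergradients of `φ`. -/
noncomputable def slope (v : Fin 3 → Plane) (y : Plane) : Plane :=
  if inner ℝ (v 0) y ≤ (inner ℝ (v 1) y : ℝ) ∧ inner ℝ (v 0) y ≤ (inner ℝ (v 2) y : ℝ) then v 0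
  else if inner ℝ (v 1) y ≤ (inner ℝ (v 2) y : ℝ) then v 1 else v 2

lemma measurable_slope (v : Fin 3 → Plane) : Measurable (slope v) := by
  have h : ∀ i j, MeasurableSet {y : Plane | inner ℝ (v i) y ≤ (inner ℝ (v j) y : ℝ)} :=
    fun i j => measurableSet_le (by fun_prop) (by fun_prop)
  exact Measurable.ite ((h 0 1).inter (h 0 2)) measurable_const
    (Measurable.ite (h 1 2) measurable_const measurable_const)

lemma slope_mem_range (v : Fin 3 → Plane) (y : Plane) : slope v y ∈ range v := by
  unfold slope
  split_ifs <;> exact mem_range_self _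

lemma inner_slope (v : Fin 3 → Plane) (y : Plane) : inner ℝ (slope v y) y = phi v y := by
  unfold slope
  split_ifs with h1 h2
  · refine (phi_eq_of_forall_le fun j => ?_).symm
    fin_cases j <;> simp [h1]
  · refine (phi_eq_of_forall_le fun j => ?_).symm
    fin_cases j
    · by_contra h
      simp only [Fin.zero_eta, not_le] at h
      exact h1 ⟨h.le, h.le.trans h2⟩
    · exact le_rfl
    · exact h2
  · refine (phi_eq_of_forall_le fun j => ?_).symm
    push Not at h2
    fin_cases j
    · by_contra h
      simp only [Fin.zero_eta, not_le, Fin.isValue] at h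
      exact h1 ⟨(h.trans h2).le, h.le⟩
    · exact h2.le
    · exact le_rfl

lemma phi_le_slope (v : Fin 3 → Plane) (y z : Plane) :
    phi v z ≤ phi v y + inner ℝ (slope v y) (z - y) :=
  phi_le_phi_add (subset_convexHull ℝ _ (slope_mem_range v y)) (inner_slope v y) z

/-- A bound for all velocities. -/
noncomputable def speed (v : Fin 3 → Plane) : ℝ := ∑ i, ‖v i‖

lemma speed_nonneg (v : Fin 3 → Plane) : 0 ≤ speed v := Finset.sum_nonneg fun _ _ => norm_nonneg _

lemma norm_le_speed (v : Fin 3 → Plane) (i : Fin 3) : ‖v i‖ ≤ speed v :=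
  Finset.single_le_sum (f := fun i => ‖v i‖) (fun _ _ => norm_nonneg _) (Finset.mem_univ i)

lemma norm_slope_le (v : Fin 3 → Plane) (y : Plane) : ‖slope v y‖ ≤ speed v := by
  obtain ⟨i, hi⟩ := slope_mem_range v y
  exact hi ▸ norm_le_speed v i

lemma measurable_phi (v : Fin 3 → Plane) : Measurable (phi v) := by
  have h : phi v = fun y => inner ℝ (slope v y) y := funext fun y => (inner_slope v y).symm
  rw [h]
  exact (measurable_slope v).inner measurable_id

lemma neg_phi_le (v : Fin 3 → Plane) (y : Plane) : -phi v y ≤ speed v * ‖y‖ := by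
  rw [← inner_slope]
  have := abs_real_inner_le_norm (slope v y) y
  have h2 := mul_le_mul_of_nonneg_right (norm_slope_le v y) (norm_nonneg y)
  linarith [neg_le_abs (inner ℝ (slope v y) y : ℝ)]

/-- The unnormalized density of the initial position, given the position `x` at time `t`. -/
noncomputable def weight (v : Fin 3 → Plane) (ε t : ℝ) (x y : Plane) : ℝ :=
  Real.exp (-(‖x - y‖ ^ 2) / (2 * ε * t) - phi v y / ε)

/-- The total mass of `weight`. -/
noncomputable def mass (v : Fin 3 → Plane) (ε t : ℝ) (x : Plane) : ℝ :=
  ∫ y : Plane, weight v ε t x y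

/-- The integral of the initial velocity against `weight`. -/
noncomputable def momentum (v : Fin 3 → Plane) (ε t : ℝ) (x : Plane) : Plane :=
  ∫ y : Plane, weight v ε t x y • slope v y

/-- The viscous velocity: the mean of the initial velocity. -/
noncomputable def drift (v : Fin 3 → Plane) (ε t : ℝ) (x : Plane) : Plane :=
  (mass v ε t x)⁻¹ • momentum v ε t x

lemma weight_pos (v : Fin 3 → Plane) (ε t : ℝ) (x y : Plane) : 0 < weight v ε t x y :=
  Real.exp_pos _

lemma measurable_weight (v : Fin 3 → Plane) (ε t : ℝ) (x : Plane) :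
    Measurable (weight v ε t x) := by
  have := measurable_phi v
  unfold weight
  fun_prop

/-- In dimension two the Gaussian integral carries no square root, which matches the factor 1/(2πεt)
in `uVisc`. -/
lemma integral_exp_neg_mul_sq_norm_plane {b : ℝ} (hb : 0 < b) :
    ∫ y : Plane, Real.exp (-b * ‖y‖ ^ 2) = Real.pi / b := by
  rw [GaussianFourier.integral_rexp_neg_mul_sq_norm hb]
  simp

lemma integrable_exp_neg_mul_sq_norm_plane {b : ℝ} (hb : 0 < b) :
    Integrable fun y : Plane => Real.exp (-b * ‖y‖ ^ 2) := by
  refine Integrable.of_integral_ne_zero ?_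
  rw [integral_exp_neg_mul_sq_norm_plane hb]
  positivity

/-- A dominating function uniform for t ≤ N and |x| ≤ R. The spare factor exp |y| later absorbs the
linear growth in y of differences of the exponent. -/
lemma exp_mul_weight_le (v : Fin 3 → Plane) {ε N : ℝ} (hε : 0 < ε) (hN : 0 < N) (R : ℝ) :
    ∃ C b : ℝ, 0 < b ∧ ∀ t, 0 < t → t ≤ N → ∀ x : Plane, ‖x‖ ≤ R → ∀ y,
      Real.exp ‖y‖ * weight v ε t x y ≤ C * Real.exp (-b * ‖y‖ ^ 2) := by
  -- The quadratic term is at least 4b|x - y|² ≥ 2b|y|² - 4bR². One b|y|² absorbs the linear growth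
  -- L|y|, the other remains.
  obtain ⟨b, hb⟩ : ∃ b, b = 1 / (8 * ε * N) := ⟨_, rfl⟩
  have hb0 : 0 < b := by rw [hb]; positivity
  obtain ⟨L, hL⟩ : ∃ L, L = 1 + speed v / ε := ⟨_, rfl⟩
  refine ⟨Real.exp (4 * b * R ^ 2 + L ^ 2 / (4 * b)), b, hb0, fun t ht htN x hx y => ?_⟩
  rw [weight, ← Real.exp_add, ← Real.exp_add, Real.exp_le_exp]
  have h1 : ‖x - y‖ ^ 2 / (2 * ε * N) ≤ ‖x - y‖ ^ 2 / (2 * ε * t) := by gcongr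
  have h2 : ‖x - y‖ ^ 2 / (2 * ε * N) = 4 * b * ‖x - y‖ ^ 2 := by rw [hb]; field_simp; ring
  have h3 : ‖y‖ ≤ ‖x - y‖ + R := by
    have := norm_sub_norm_le y x
    rw [norm_sub_rev] at this
    linarith
  have h4 : ‖y‖ ^ 2 / 2 - R ^ 2 ≤ ‖x - y‖ ^ 2 := by
    have := pow_le_pow_left₀ (norm_nonneg y) h3 2
    nlinarith [sq_nonneg (‖x - y‖ - R)]
  have h5 := mul_le_mul_of_nonneg_left h4 (by positivity : 0 ≤ 4 * b)
  have h6 : L * ‖y‖ ≤ b * ‖y‖ ^ 2 + L ^ 2 / (4 * b) := by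
    have : b * ‖y‖ ^ 2 + L ^ 2 / (4 * b) - L * ‖y‖ = (2 * b * ‖y‖ - L) ^ 2 / (4 * b) := by
      field_simp; ring
    have h7 : 0 ≤ (2 * b * ‖y‖ - L) ^ 2 / (4 * b) := by positivity
    linarith
  have h7 : -(phi v y / ε) ≤ (L - 1) * ‖y‖ := by
    rw [hL, add_sub_cancel_left, div_mul_eq_mul_div, ← neg_div]
    gcongr
    exact neg_phi_le v y
  rw [neg_div]
  linarith

lemma exists_integrable_exp_mul_weight_le (v : Fin 3 → Plane) {ε N : ℝ} (hε : 0 < ε) (hN : 0 < N) (R : ℝ) :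
    ∃ g : Plane → ℝ, Integrable g ∧ ∀ t, 0 < t → t ≤ N → ∀ x : Plane, ‖x‖ ≤ R → ∀ y,
      Real.exp ‖y‖ * weight v ε t x y ≤ g y := by
  obtain ⟨C, b, hb, h⟩ := exp_mul_weight_le v hε hN R
  exact ⟨_, (integrable_exp_neg_mul_sq_norm_plane hb).const_mul C, h⟩

lemma weight_le_exp_mul_weight (v : Fin 3 → Plane) (ε t : ℝ) (x y : Plane) :
    weight v ε t x y ≤ Real.exp ‖y‖ * weight v ε t x y :=
  le_mul_of_one_le_left (weight_pos ..).le (Real.one_le_exp (norm_nonneg y))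

lemma integrable_weight (v : Fin 3 → Plane) {ε t : ℝ} (hε : 0 < ε) (ht : 0 < t) (x : Plane) :
    Integrable (weight v ε t x) := by
  obtain ⟨g, hg, h⟩ := exists_integrable_exp_mul_weight_le v hε ht ‖x‖
  refine hg.mono' (measurable_weight v ε t x).aestronglyMeasurable (ae_of_all _ fun y => ?_)
  rw [Real.norm_of_nonneg (weight_pos ..).le]
  exact (weight_le_exp_mul_weight v ε t x y).trans (h t ht le_rfl x le_rfl y)

lemma norm_weight_smul_slope_le (v : Fin 3 → Plane) (ε t : ℝ) (x y : Plane) :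
    ‖weight v ε t x y • slope v y‖ ≤ weight v ε t x y * speed v := by
  rw [norm_smul, Real.norm_of_nonneg (weight_pos ..).le]
  exact mul_le_mul_of_nonneg_left (norm_slope_le v y) (weight_pos ..).le

lemma integrable_weight_smul_slope (v : Fin 3 → Plane) {ε t : ℝ} (hε : 0 < ε) (ht : 0 < t)
    (x : Plane) : Integrable fun y => weight v ε t x y • slope v y :=
  ((integrable_weight v hε ht x).mul_const (speed v)).mono'
    ((measurable_weight v ε t x).smul (measurable_slope v)).aestronglyMeasurable
    (ae_of_all _ (norm_weight_smul_slope_le v ε t x))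

/-! #### Comparison with the inviscid potential -/

lemma exponent_eq {ε t : ℝ} (hε : 0 < ε) (ht : 0 < t) (x y a : Plane) :
    -(‖x - y‖ ^ 2) / (2 * ε * t) - inner ℝ a y / ε =
      -(inner ℝ a x - t / 2 * ‖a‖ ^ 2) / ε + -(1 / (2 * ε * t)) * ‖y - (x - t • a)‖ ^ 2 := by
  have h : y - (x - t • a) = (y - x) + t • a := by abel
  rw [h, sq_norm_add_smul, norm_sub_rev x y, inner_sub_right]
  field_simp
  ring

lemma integrable_exp_affine {ε t : ℝ} (hε : 0 < ε) (ht : 0 < t) (x a : Plane) :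
    Integrable fun y : Plane => Real.exp (-(‖x - y‖ ^ 2) / (2 * ε * t) - inner ℝ a y / ε) := by
  simp only [exponent_eq hε ht, Real.exp_add]
  exact ((integrable_exp_neg_mul_sq_norm_plane (b := 1 / (2 * ε * t))
    (by positivity)).comp_sub_right (x - t • a)).const_mul _

lemma integral_exp_affine {ε t : ℝ} (hε : 0 < ε) (ht : 0 < t) (x a : Plane) :
    ∫ y : Plane, Real.exp (-(‖x - y‖ ^ 2) / (2 * ε * t) - inner ℝ a y / ε) =
      2 * Real.pi * ε * t * Real.exp (-(inner ℝ a x - t / 2 * ‖a‖ ^ 2) / ε) := by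
  simp only [exponent_eq hε ht, Real.exp_add, integral_const_mul]
  rw [integral_sub_right_eq_self (fun y : Plane => Real.exp (-(1 / (2 * ε * t)) * ‖y‖ ^ 2)),
    integral_exp_neg_mul_sq_norm_plane (by positivity)]
  field_simp

lemma le_mass (v : Fin 3 → Plane) {ε t : ℝ} (hε : 0 < ε) (ht : 0 < t) (x : Plane) (i : Fin 3) :
    2 * Real.pi * ε * t * Real.exp (-(inner ℝ (v i) x - t / 2 * ‖v i‖ ^ 2) / ε) ≤
      mass v ε t x := by
  rw [← integral_exp_affine hε ht]
  refine integral_mono (integrable_exp_affine hε ht x (v i)) (integrable_weight v hε ht x)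
    fun y => ?_
  simp only [weight]
  gcongr
  exact phi_le v y i

lemma mass_pos (v : Fin 3 → Plane) {ε t : ℝ} (hε : 0 < ε) (ht : 0 < t) (x : Plane) :
    0 < mass v ε t x :=
  lt_of_lt_of_le (by positivity) (le_mass v hε ht x 0)

/-- exp(-φ/ε) is the maximum of three exponentials, hence at most their sum; the number of summands
is the source of log 3. -/
lemma mass_le (v : Fin 3 → Plane) {ε t : ℝ} (hε : 0 < ε) (ht : 0 < t) (x : Plane) :
    mass v ε t x ≤ 2 * Real.pi * ε * t *
      ∑ i, Real.exp (-(inner ℝ (v i) x - t / 2 * ‖v i‖ ^ 2) / ε) := by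
  rw [Finset.mul_sum]
  simp only [← integral_exp_affine hε ht]
  rw [← integral_finsetSum _ fun i _ => integrable_exp_affine hε ht x (v i)]
  refine integral_mono (integrable_weight v hε ht x)
    (integrable_finsetSum _ fun i _ => integrable_exp_affine hε ht x (v i)) fun y => ?_
  obtain ⟨i, hi⟩ := exists_phi_eq v y
  simp only [weight, hi]
  exact Finset.single_le_sum
    (f := fun i => Real.exp (-(‖x - y‖ ^ 2) / (2 * ε * t) - inner ℝ (v i) y / ε))
    (fun _ _ => (Real.exp_pos _).le) (Finset.mem_univ i)

lemma uVisc_eq (v : Fin 3 → Plane) (ε t : ℝ) (x : Plane) :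
    uVisc v ε t x = -ε * Real.log ((2 * Real.pi * ε * t)⁻¹ * mass v ε t x) := rfl

lemma uVisc_le_u (v : Fin 3 → Plane) {ε t : ℝ} (hε : 0 < ε) (ht : 0 < t) (x : Plane) :
    uVisc v ε t x ≤ u v t x := by
  refine le_u ht fun i => ?_
  have h : Real.exp (-(inner ℝ (v i) x - t / 2 * ‖v i‖ ^ 2) / ε) ≤
      (2 * Real.pi * ε * t)⁻¹ * mass v ε t x := by
    rw [inv_mul_eq_div, le_div_iff₀ (by positivity), mul_comm]
    exact le_mass v hε ht x i
  have h2 := Real.log_le_log (Real.exp_pos _) h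
  rw [Real.log_exp, div_le_iff₀ hε] at h2
  rw [uVisc_eq]
  linarith

lemma u_sub_le_uVisc (v : Fin 3 → Plane) {ε t : ℝ} (hε : 0 < ε) (ht : 0 < t) (x : Plane) :
    u v t x - ε * Real.log 3 ≤ uVisc v ε t x := by
  have h : (2 * Real.pi * ε * t)⁻¹ * mass v ε t x ≤ 3 * Real.exp (-u v t x / ε) := by
    rw [inv_mul_eq_div, div_le_iff₀ (by positivity), mul_comm]
    refine (mass_le v hε ht x).trans ?_
    gcongr
    calc _ ≤ ∑ _i : Fin 3, Real.exp (-u v t x / ε) := by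
          gcongr with i
          exact u_le v ht x i
      _ = _ := by simp
  have h2 := Real.log_le_log (mul_pos (by positivity) (mass_pos v hε ht x)) h
  rw [Real.log_mul (by norm_num) (Real.exp_pos _).ne', Real.log_exp] at h2
  have h3 := mul_le_mul_of_nonneg_left h2 hε.le
  rw [mul_add, mul_div_cancel₀ _ hε.ne'] at h3
  rw [uVisc_eq]
  linarith

/-! #### The velocity is the gradient of the viscous potential -/

/-- Translating the integration variable by z - x and using concavity of φ reduces this to Jensen's
inequality for exp under the normalized weight. It gives both concavity and, with continuity of the
drift, the gradient, without differentiating the integral. -/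
lemma uVisc_le_add_drift (v : Fin 3 → Plane) {ε t : ℝ} (hε : 0 < ε) (ht : 0 < t)
    (x z : Plane) : uVisc v ε t z ≤ uVisc v ε t x + inner ℝ (drift v ε t x) (z - x) := by
  have hm := mass_pos v hε ht x
  obtain ⟨b, hb⟩ : ∃ b : ℝ, b = -inner ℝ (drift v ε t x) (z - x) / ε := ⟨_, rfl⟩
  have hw := integrable_weight v hε ht x
  have hws := integrable_weight_smul_slope v hε ht x
  have hwi : Integrable fun y => inner ℝ (z - x) (weight v ε t x y • slope v y) :=
    hws.const_inner (z - x)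
  have hI : ∫ y : Plane, inner ℝ (z - x) (weight v ε t x y • slope v y) =
      mass v ε t x * (-b * ε) := by
    rw [integral_inner hws, hb, drift, real_inner_smul_left, real_inner_comm, momentum]
    field_simp
  have key : Real.exp b * mass v ε t x ≤ mass v ε t z := by
    have h1 : mass v ε t z = ∫ y : Plane, weight v ε t z (y + (z - x)) :=
      (integral_add_right_eq_self (weight v ε t z) (z - x)).symm
    have h2 : Real.exp b * mass v ε t x = ∫ y : Plane,
        (Real.exp b * (1 - b) * weight v ε t x y -
          Real.exp b / ε * inner ℝ (z - x) (weight v ε t x y • slope v y)) := by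
      rw [integral_sub (hw.const_mul _) (hwi.const_mul _), integral_const_mul,
        integral_const_mul, hI, mass]
      field_simp
      ring
    rw [h1, h2]
    refine integral_mono ((hw.const_mul _).sub (hwi.const_mul _))
      ((integrable_weight v hε ht z).comp_add_right (z - x)) fun y => ?_
    obtain ⟨s, hs⟩ : ∃ s : ℝ, s = inner ℝ (slope v y) (z - x) := ⟨_, rfl⟩
    have h3 : weight v ε t x y * Real.exp (-s / ε) ≤ weight v ε t z (y + (z - x)) := by
      have h4 := phi_le_slope v y (y + (z - x))
      rw [add_sub_cancel_left, ← hs] at h4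
      have h5 : z - (y + (z - x)) = x - y := by abel
      rw [weight, weight, ← Real.exp_add, h5, Real.exp_le_exp]
      have h6 : phi v (y + (z - x)) / ε ≤ phi v y / ε + s / ε := by
        rw [← add_div]; gcongr
      rw [neg_div ε s]
      linarith
    refine le_trans ?_ h3
    -- Jensen by hand: the tangent line of exp at b, the mean of -s/ε; its linear term integrates to
    -- zero.
    have h7 : Real.exp b * (1 + (-s / ε - b)) ≤ Real.exp (-s / ε) := by
      have h8 := Real.add_one_le_exp (-s / ε - b)
      calc _ ≤ Real.exp b * Real.exp (-s / ε - b) := by gcongr; linarith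
        _ = _ := by rw [← Real.exp_add]; congr 1; ring
    have h9 := mul_le_mul_of_nonneg_left h7 (weight_pos v ε t x y).le
    refine le_trans (le_of_eq ?_) h9
    simp only [inner_smul_right, real_inner_comm, ← hs]
    field_simp
    ring
  have h2 := Real.log_le_log (by positivity) key
  rw [Real.log_mul (Real.exp_pos _).ne' hm.ne', Real.log_exp] at h2
  have hc : (2 * Real.pi * ε * t)⁻¹ ≠ 0 := by positivity
  rw [uVisc_eq, uVisc_eq, Real.log_mul hc hm.ne', Real.log_mul hc (mass_pos v hε ht z).ne']
  have h3 := mul_le_mul_of_nonneg_left h2 hε.le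
  have h4 : ε * b = -inner ℝ (drift v ε t x) (z - x) := by rw [hb]; field_simp
  linarith

lemma norm_drift_le (v : Fin 3 → Plane) {ε t : ℝ} (hε : 0 < ε) (ht : 0 < t) (x : Plane) :
    ‖drift v ε t x‖ ≤ speed v := by
  have hm := mass_pos v hε ht x
  have h : ‖momentum v ε t x‖ ≤ mass v ε t x * speed v := by
    rw [mass, ← integral_mul_const]
    exact norm_integral_le_of_norm_le ((integrable_weight v hε ht x).mul_const _)
      (ae_of_all _ (norm_weight_smul_slope_le v ε t x))
  rw [drift, norm_smul, norm_inv, Real.norm_of_nonneg hm.le, inv_mul_le_iff₀ hm]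
  exact h

lemma abs_exp_sub_exp_le_mul {a b w : ℝ} (ha : Real.exp a ≤ w) (hb : Real.exp b ≤ w) :
    |Real.exp a - Real.exp b| ≤ w * |a - b| := by
  wlog hab : b ≤ a generalizing a b
  · rw [abs_sub_comm, abs_sub_comm a b]
    exact this hb ha (le_of_not_ge hab)
  rw [abs_of_nonneg (sub_nonneg.2 (Real.exp_le_exp.2 hab)), abs_of_nonneg (sub_nonneg.2 hab)]
  have h1 := Real.add_one_le_exp (b - a)
  have h2 : Real.exp b = Real.exp a * Real.exp (b - a) := by
    rw [← Real.exp_add]; congr 1; ring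
  have h3 := mul_le_mul_of_nonneg_left h1 (Real.exp_pos a).le
  have h4 := mul_le_mul_of_nonneg_right ha (sub_nonneg.2 hab)
  rw [h2]
  linarith

lemma abs_weight_sub_weight_le (v : Fin 3 → Plane) {ε δ N R : ℝ} (hε : 0 < ε) (hδ : 0 < δ)
    (hR : 0 ≤ R) {g : Plane → ℝ} (hg : ∀ t, 0 < t → t ≤ N → ∀ x : Plane, ‖x‖ ≤ R → ∀ y,
      Real.exp ‖y‖ * weight v ε t x y ≤ g y) {t : ℝ} (ht : t ∈ Icc δ N) {x z : Plane}
    (hx : ‖x‖ ≤ R) (hz : ‖z‖ ≤ R) (y : Plane) :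
    |weight v ε t x y - weight v ε t z y| ≤ g y * ((R + 1) / (ε * δ) * ‖x - z‖) := by
  have ht0 : 0 < t := hδ.trans_le ht.1
  have hle : ∀ x : Plane, ‖x‖ ≤ R → weight v ε t x y ≤ Real.exp (-‖y‖) * g y := fun x hx => by
    rw [Real.exp_neg, inv_mul_eq_div, le_div_iff₀ (Real.exp_pos _), mul_comm]
    exact hg t ht0 ht.2 x hx y
  have hg0 : 0 ≤ g y := le_trans (by have := weight_pos v ε t x y; positivity)
    (hg t ht0 ht.2 x hx y)
  have h1 := abs_exp_sub_exp_le_mul (hle x hx) (hle z hz)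
  refine h1.trans ?_
  have h2 : |-(‖x - y‖ ^ 2) / (2 * ε * t) - phi v y / ε -
      (-(‖z - y‖ ^ 2) / (2 * ε * t) - phi v y / ε)| ≤
      Real.exp ‖y‖ * ((R + 1) / (ε * δ) * ‖x - z‖) := by
    have h3 : -(‖x - y‖ ^ 2) / (2 * ε * t) - phi v y / ε -
      (-(‖z - y‖ ^ 2) / (2 * ε * t) - phi v y / ε) =
      (‖z - y‖ - ‖x - y‖) * (‖z - y‖ + ‖x - y‖) / (2 * ε * t) := by ring
    have h4 : |‖z - y‖ - ‖x - y‖| ≤ ‖x - z‖ := by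
      have := abs_norm_sub_norm_le (z - y) (x - y)
      rwa [sub_sub_sub_cancel_right, norm_sub_rev z x] at this
    have h5 : ‖z - y‖ + ‖x - y‖ ≤ 2 * (R + 1) * Real.exp ‖y‖ := by
      have h6 := norm_sub_le z y
      have h7 := norm_sub_le x y
      have h8 := Real.add_one_le_exp ‖y‖
      nlinarith [norm_nonneg y]
    rw [h3, abs_div, abs_mul, abs_of_nonneg (by positivity : 0 ≤ ‖z - y‖ + ‖x - y‖),
      abs_of_pos (by positivity : 0 < 2 * ε * t)]
    calc |‖z - y‖ - ‖x - y‖| * (‖z - y‖ + ‖x - y‖) / (2 * ε * t)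
        ≤ ‖x - z‖ * (2 * (R + 1) * Real.exp ‖y‖) / (2 * ε * δ) := by
          gcongr
          exact ht.1
      _ = _ := by field_simp
  calc _ ≤ Real.exp (-‖y‖) * g y * (Real.exp ‖y‖ * ((R + 1) / (ε * δ) * ‖x - z‖)) := by
        gcongr
    _ = (Real.exp (-‖y‖) * Real.exp ‖y‖) * (g y * ((R + 1) / (ε * δ) * ‖x - z‖)) := by ring
    _ = _ := by rw [← Real.exp_add, neg_add_cancel, Real.exp_zero, one_mul]

/-- The viscous velocity is Lipschitz on bounded sets, locally uniformly in positive time. -/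
lemma exists_lipschitz_drift (v : Fin 3 → Plane) {ε δ N R : ℝ} (hε : 0 < ε) (hδ : 0 < δ)
    (hN : 0 < N) (hR : 0 ≤ R) : ∃ K : ℝ, 0 ≤ K ∧ ∀ t ∈ Icc δ N, ∀ x z : Plane,
      ‖x‖ ≤ R → ‖z‖ ≤ R → ‖drift v ε t x - drift v ε t z‖ ≤ K * ‖x - z‖ := by
  obtain ⟨g, hgi, hg⟩ := exists_integrable_exp_mul_weight_le v hε hN R
  have hg0 : 0 ≤ ∫ y, g y := integral_nonneg fun y => le_trans
    (by have := weight_pos v ε N 0 y; positivity) (hg N hN le_rfl 0 (by simpa using hR) y)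
  obtain ⟨A, hA⟩ : ∃ A, A = (∫ y, g y) * ((R + 1) / (ε * δ)) := ⟨_, rfl⟩
  have hA0 : 0 ≤ A := by rw [hA]; positivity
  -- A uniform lower bound for the mass, from the Gaussian of `v 0` in `le_mass`.
  obtain ⟨m, hm⟩ : ∃ m, m = 2 * Real.pi * ε * δ * Real.exp (-(speed v * R) / ε) := ⟨_, rfl⟩
  have hm0 : 0 < m := by rw [hm]; positivity
  have hS := speed_nonneg v
  refine ⟨2 * speed v * A / m, by positivity, fun t ht x z hx hz => ?_⟩
  have ht0 : 0 < t := hδ.trans_le ht.1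
  have hw := abs_weight_sub_weight_le v hε hδ hR hg ht hx hz
  have hgK : Integrable fun y => g y * ((R + 1) / (ε * δ) * ‖x - z‖) := hgi.mul_const _
  have hmass : |mass v ε t x - mass v ε t z| ≤ A * ‖x - z‖ := by
    rw [mass, mass, ← integral_sub (integrable_weight v hε ht0 x) (integrable_weight v hε ht0 z),
      ← Real.norm_eq_abs]
    refine (norm_integral_le_of_norm_le hgK (ae_of_all _ hw)).trans (le_of_eq ?_)
    rw [integral_mul_const, hA, mul_assoc]
  have hmom : ‖momentum v ε t x - momentum v ε t z‖ ≤ A * ‖x - z‖ * speed v := by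
    rw [momentum, momentum, ← integral_sub (integrable_weight_smul_slope v hε ht0 x)
      (integrable_weight_smul_slope v hε ht0 z)]
    refine (norm_integral_le_of_norm_le (hgK.mul_const (speed v))
      (ae_of_all _ fun y => ?_)).trans (le_of_eq ?_)
    · rw [← sub_smul, norm_smul]
      exact mul_le_mul (hw y) (norm_slope_le v y) (norm_nonneg _) ((abs_nonneg _).trans (hw y))
    · rw [integral_mul_const, integral_mul_const, hA]; ring
  have hmx : m ≤ mass v ε t x := by
    refine le_trans ?_ (le_mass v hε ht0 x 0)
    rw [hm]
    have h1 : inner ℝ (v 0) x ≤ speed v * R := (real_inner_le_norm _ _).trans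
      (mul_le_mul (norm_le_speed v 0) hx (norm_nonneg _) hS)
    have h2 : 0 ≤ t / 2 * ‖v 0‖ ^ 2 := by positivity
    have h3 := ht.1
    gcongr
    linarith
  have hmx0 : 0 < mass v ε t x := hm0.trans_le hmx
  have hmz0 := mass_pos v hε ht0 z
  have hsplit : drift v ε t x - drift v ε t z = (mass v ε t x)⁻¹ •
      ((momentum v ε t x - momentum v ε t z) -
        (mass v ε t x - mass v ε t z) • drift v ε t z) := by
    have h1 : momentum v ε t z = mass v ε t z • drift v ε t z := by
      rw [drift, smul_inv_smul₀ hmz0.ne']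
    have h2 : drift v ε t z = (mass v ε t x)⁻¹ • mass v ε t x • drift v ε t z := by
      rw [inv_smul_smul₀ hmx0.ne']
    have h3 : drift v ε t x = (mass v ε t x)⁻¹ • momentum v ε t x := rfl
    rw [h1, h3]
    nth_rewrite 1 [h2]
    rw [← smul_sub]
    congr 1
    module
  have hd := norm_drift_le v hε ht0 z
  rw [hsplit, norm_smul, norm_inv, Real.norm_of_nonneg hmx0.le, inv_mul_eq_div]
  calc _ ≤ (A * ‖x - z‖ * speed v + A * ‖x - z‖ * speed v) / m := by
        gcongr
        refine (norm_sub_le _ _).trans (add_le_add hmom ?_)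
        rw [norm_smul]
        exact mul_le_mul hmass hd (norm_nonneg _) (by positivity)
    _ = _ := by ring

lemma hasGradientAt_uVisc (v : Fin 3 → Plane) {ε t : ℝ} (hε : 0 < ε) (ht : 0 < t) (x : Plane) :
    HasGradientAt (uVisc v ε t) (drift v ε t x) x := by
  refine hasGradientAt_of_supergradient (uVisc_le_add_drift v hε ht) ?_
  obtain ⟨K, hK, h⟩ := exists_lipschitz_drift v hε ht ht (by positivity : 0 ≤ ‖x‖ + 1)
  refine continuousAt_of_locally_lipschitz one_pos K fun z hz => ?_
  rw [dist_eq_norm, dist_eq_norm]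
  refine h t (by simp) z x ?_ (by linarith)
  rw [dist_eq_norm] at hz
  have := norm_sub_norm_le z x
  linarith

lemma continuousOn_drift (v : Fin 3 → Plane) {ε δ N : ℝ} (hε : 0 < ε) (hδ : 0 < δ) (hN : 0 < N)
    (x : Plane) : ContinuousOn (fun t => drift v ε t x) (Icc δ N) := by
  obtain ⟨g, hgi, hg⟩ := exists_integrable_exp_mul_weight_le v hε hN ‖x‖
  have hle : ∀ t ∈ Icc δ N, ∀ y, weight v ε t x y ≤ g y := fun t ht y =>
    (weight_le_exp_mul_weight v ε t x y).trans (hg t (hδ.trans_le ht.1) ht.2 x le_rfl y)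
  have hcont : ∀ y, ContinuousOn (fun t => weight v ε t x y) (Icc δ N) := fun y => by
    unfold weight
    refine Real.continuous_exp.comp_continuousOn (ContinuousOn.sub (ContinuousOn.div
      continuousOn_const (by fun_prop) fun t ht => ?_) continuousOn_const)
    have : 0 < t := hδ.trans_le ht.1
    positivity
  have h1 : ContinuousOn (fun t => mass v ε t x) (Icc δ N) := by
    refine continuousOn_of_dominated (bound := g)
      (fun t _ => (measurable_weight v ε t x).aestronglyMeasurable)
      (fun t ht => ae_of_all _ fun y => ?_) hgi (ae_of_all _ hcont)
    rw [Real.norm_of_nonneg (weight_pos ..).le]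
    exact hle t ht y
  have h2 : ContinuousOn (fun t => momentum v ε t x) (Icc δ N) := by
    refine continuousOn_of_dominated (bound := fun y => g y * speed v)
      (fun t _ => ((measurable_weight v ε t x).smul (measurable_slope v)).aestronglyMeasurable)
      (fun t ht => ae_of_all _ fun y => ?_) (hgi.mul_const _)
      (ae_of_all _ fun y => (hcont y).smul continuousOn_const)
    exact (norm_weight_smul_slope_le v ε t x y).trans
      (mul_le_mul_of_nonneg_right (hle t ht y) (speed_nonneg v))
  exact (h1.inv₀ fun t ht => (mass_pos v hε (hδ.trans_le ht.1) x).ne').smul h2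

lemma drift_mem_differential (v : Fin 3 → Plane) {ε t : ℝ} (hε : 0 < ε) (ht : 0 < t)
    (x : Plane) : drift v ε t x ∈ differential 0 (uVisc v ε t) x :=
  mem_differential_zero.2 (uVisc_le_add_drift v hε ht x)

/-! ### Comparison of trajectories -/

/-- The derivative is assumed only in the open interval, because paths are merely continuous at time
0 and T is only shown to have right derivatives. The bound from s > a passes to the limit s → a. -/
lemma le_add_mul_of_right_deriv_le {f f' : ℝ → ℝ} {a b C : ℝ} (hab : a ≤ b)
    (hf : ContinuousOn f (Icc a b))
    (hd : ∀ t ∈ Ioo a b, HasDerivWithinAt f (f' t) (Ici t) t) (hC : ∀ t ∈ Ioo a b, f' t ≤ C) :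
    f b ≤ f a + C * (b - a) := by
  rcases hab.eq_or_lt with rfl | hlt
  · simp
  have h1 : ∀ s ∈ Ioo a b, f b ≤ f s + C * (b - s) := fun s hs => by
    have hsub : Ico s b ⊆ Ioo a b := fun t ht => ⟨hs.1.trans_le ht.1, ht.2⟩
    refine image_le_of_deriv_right_le_deriv_boundary
      (B := fun t => f s + C * (t - s)) (B' := fun _ => C)
      (hf.mono (Icc_subset_Icc_left hs.1.le)) (fun t ht => hd t (hsub ht)) (by simp)
      (by fun_prop) (fun t _ => ?_) (fun t ht => hC t (hsub ht)) (right_mem_Icc.2 hs.2.le)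
    simpa using ((((hasDerivAt_id t).sub_const s).const_mul C).const_add (f s)).hasDerivWithinAt
  have h2 : Tendsto (fun s => f s + C * (b - s)) (𝓝[Ioo a b] a) (𝓝 (f a + C * (b - a))) :=
    (((hf a (left_mem_Icc.2 hab)).mono Ioo_subset_Icc_self).add
      (by fun_prop : ContinuousWithinAt (fun s => C * (b - s)) (Ioo a b) a))
  have : (𝓝[Ioo a b] a).NeBot := left_nhdsWithin_Ioo_neBot hlt
  exact ge_of_tendsto h2 (eventually_mem_nhdsWithin.mono h1)

/-- Two trajectories whose velocities are supergradients of uniformly close potentials. -/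
lemma norm_sub_sq_le_of_supergradient {α β p q : ℝ → Plane} {f g : ℝ → Plane → ℝ}
    {a b A B : ℝ} (hab : a ≤ b) (hα : ContinuousOn α (Icc a b)) (hβ : ContinuousOn β (Icc a b))
    (hαd : ∀ t ∈ Ioo a b, HasDerivWithinAt α (p t) (Ici t) t)
    (hβd : ∀ t ∈ Ioo a b, HasDerivWithinAt β (q t) (Ici t) t)
    (hp : ∀ t ∈ Ioo a b, p t ∈ differential 0 (f t) (α t))
    (hq : ∀ t ∈ Ioo a b, q t ∈ differential 0 (g t) (β t))
    (hA : ∀ t ∈ Ioo a b, ∀ x, g t x - A ≤ f t x) (hB : ∀ t ∈ Ioo a b, ∀ x, f t x ≤ g t x + B) :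
    ‖α b - β b‖ ^ 2 ≤ ‖α a - β a‖ ^ 2 + 2 * (A + B) * (b - a) := by
  refine le_add_mul_of_right_deriv_le (f := fun t => ‖α t - β t‖ ^ 2) hab ((hα.sub hβ).norm.pow 2)
    (fun t ht => ((hαd t ht).sub (hβd t ht)).norm_sq) fun t ht => ?_
  have := inner_supergradient_sub_le (hp t ht) (hq t ht) (hA t ht) (hB t ht)
  rw [real_inner_comm] at this
  simp only [Pi.sub_apply]
  linarith

/-! ### Existence of the viscous flow -/

/-- `α` solves the viscous equation on `[a, b]`. -/
def IsDriftPath (v : Fin 3 → Plane) (ε a b : ℝ) (α : ℝ → Plane) : Prop :=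
  ∀ t ∈ Icc a b, HasDerivWithinAt α (drift v ε t (α t)) (Icc a b) t

lemma IsDriftPath.mono {v : Fin 3 → Plane} {ε a b a' b' : ℝ} {α : ℝ → Plane}
    (h : IsDriftPath v ε a b α) (hs : Icc a' b' ⊆ Icc a b) : IsDriftPath v ε a' b' α :=
  fun t ht => (h t (hs ht)).mono hs

lemma IsDriftPath.hasDerivAt {v : Fin 3 → Plane} {ε a b t : ℝ} {α : ℝ → Plane}
    (h : IsDriftPath v ε a b α) (ht : t ∈ Ioo a b) : HasDerivAt α (drift v ε t (α t)) t :=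
  (h t (Ioo_subset_Icc_self ht)).hasDerivAt (Icc_mem_nhds ht.1 ht.2)

lemma IsDriftPath.norm_sub_le {v : Fin 3 → Plane} {ε a b : ℝ} {α β : ℝ → Plane} (hε : 0 < ε)
    (ha : 0 < a) (hab : a ≤ b) (hα : IsDriftPath v ε a b α) (hβ : IsDriftPath v ε a b β) :
    ‖α b - β b‖ ≤ ‖α a - β a‖ := by
  have h := norm_sub_sq_le_of_supergradient (f := uVisc v ε) (g := uVisc v ε) (A := 0) (B := 0)
    hab (fun t ht => (hα t ht).continuousWithinAt) (fun t ht => (hβ t ht).continuousWithinAt)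
    (fun t ht => (hα.hasDerivAt ht).hasDerivWithinAt)
    (fun t ht => (hβ.hasDerivAt ht).hasDerivWithinAt)
    (fun t ht => drift_mem_differential v hε (ha.trans ht.1) _)
    (fun t ht => drift_mem_differential v hε (ha.trans ht.1) _)
    (fun t _ x => by simp) (fun t _ x => by simp)
  refine le_of_sq_le_sq ?_ (norm_nonneg _)
  linarith

lemma IsDriftPath.norm_sub_le_speed {v : Fin 3 → Plane} {ε a b : ℝ} {α : ℝ → Plane} (hε : 0 < ε)
    (ha : 0 < a) (hab : a ≤ b) (hα : IsDriftPath v ε a b α) :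
    ‖α b - α a‖ ≤ speed v * (b - a) := by
  have := (convex_Icc a b).norm_image_sub_le_of_norm_hasDerivWithin_le hα
    (fun t ht => norm_drift_le v hε (ha.trans_le ht.1) _) (left_mem_Icc.2 hab)
    (right_mem_Icc.2 hab)
  rwa [Real.norm_of_nonneg (sub_nonneg.2 hab)] at this

lemma exists_isDriftPath (v : Fin 3 → Plane) {ε a b : ℝ} (hε : 0 < ε) (ha : 0 < a) (hab : a ≤ b)
    (y : Plane) : ∃ α, α a = y ∧ IsDriftPath v ε a b α := by
  have hS := speed_nonneg v
  -- A path of velocity at most `speed v` cannot leave this ball before time b, so Picard-Lindelöf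
  -- covers all of [a, b].
  obtain ⟨r, hr⟩ : ∃ r : NNReal, (r : ℝ) = speed v * (b - a) :=
    ⟨⟨_, mul_nonneg hS (sub_nonneg.2 hab)⟩, rfl⟩
  obtain ⟨K, hK, hKl⟩ := exists_lipschitz_drift v hε ha (ha.trans_le hab)
    (by positivity : 0 ≤ ‖y‖ + r)
  have hball : ∀ x ∈ Metric.closedBall y (r : ℝ), ‖x‖ ≤ ‖y‖ + r := fun x hx => by
    rw [mem_closedBall_iff_norm] at hx
    linarith [norm_sub_norm_le x y]
  have hPL : IsPicardLindelof (drift v ε) (⟨a, left_mem_Icc.2 hab⟩ : Icc a b) y r 0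
      ⟨speed v, hS⟩ ⟨K, hK⟩ :=
    { lipschitzOnWith := fun t ht => LipschitzOnWith.of_dist_le_mul fun x hx z hz => by
        rw [dist_eq_norm, dist_eq_norm]
        exact hKl t ht x z (hball x hx) (hball z hz)
      continuousOn := fun x _ => continuousOn_drift v hε ha (ha.trans_le hab) x
      norm_le := fun t ht x _ => norm_drift_le v hε (ha.trans_le ht.1) x
      mul_max_le := by
        simp only [sub_self, NNReal.coe_zero, sub_zero, hr]
        rw [max_eq_left (sub_nonneg.2 hab)]
        exact le_rfl }
  exact hPL.exists_eq_forall_mem_Icc_hasDerivWithinAt₀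

/-- The viscous trajectory from `y` is the limit of those that start at small positive times. -/
lemma exists_viscous_path (v : Fin 3 → Plane) {ε : ℝ} (hε : 0 < ε) (y : Plane) :
    ∃ z : ℝ → Plane, z 0 = y ∧ ContinuousOn z (Ici 0) ∧
      ∀ t, 0 < t → HasDerivAt z (drift v ε t (z t)) t := by
  have hS := speed_nonneg v
  have ha0 : ∀ n : ℕ, 0 < 1 / ((n : ℝ) + 1) := fun n => by positivity
  have hanti : ∀ {n m : ℕ}, n ≤ m → 1 / ((m : ℝ) + 1) ≤ 1 / ((n : ℝ) + 1) :=
    fun h => Nat.one_div_le_one_div h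
  have hle : ∀ n : ℕ, 1 / ((n : ℝ) + 1) ≤ (n : ℝ) + 1 := fun n => by
    refine le_trans (b := 1) ?_ (by simp)
    rw [div_le_one (by positivity)]; simp
  -- The Lipschitz bound is available only away from t = 0, so paths start from y at time 1/(n+1). A
  -- later-indexed path has moved at most speed/(n+1) by then, and contraction preserves this gap.
  choose α hα0 hα using fun n : ℕ => exists_isDriftPath v hε (ha0 n) (hle n) y
  have hdisp : ∀ n : ℕ, ∀ t ∈ Icc (1 / ((n : ℝ) + 1)) ((n : ℝ) + 1), ‖α n t - y‖ ≤
      speed v * (t - 1 / ((n : ℝ) + 1)) := fun n t ht => by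
    have := ((hα n).mono (Icc_subset_Icc_right ht.2)).norm_sub_le_speed hε (ha0 n) ht.1
    rwa [hα0] at this
  have hclose : ∀ n m : ℕ, n ≤ m → ∀ t ∈ Icc (1 / ((n : ℝ) + 1)) ((n : ℝ) + 1),
      ‖α m t - α n t‖ ≤ speed v * (1 / ((n : ℝ) + 1)) := fun n m hnm t ht => by
    have hnm' : (n : ℝ) + 1 ≤ (m : ℝ) + 1 := by gcongr
    refine (IsDriftPath.norm_sub_le hε (ha0 n) ht.1
      ((hα m).mono (Icc_subset_Icc (hanti hnm) (ht.2.trans hnm')))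
      ((hα n).mono (Icc_subset_Icc_right ht.2))).trans ?_
    rw [hα0]
    refine (hdisp m _ ⟨hanti hnm, (hle n).trans hnm'⟩).trans ?_
    gcongr
    linarith [ha0 m]
  have hlim0 : Tendsto (fun n : ℕ => 1 / ((n : ℝ) + 1)) atTop (𝓝 0) :=
    tendsto_one_div_add_atTop_nhds_zero_nat
  have hev : ∀ t, 0 < t → ∀ᶠ n : ℕ in atTop, t ∈ Icc (1 / ((n : ℝ) + 1)) ((n : ℝ) + 1) :=
    fun t ht => by
      filter_upwards [hlim0.eventually_le_const ht,
        tendsto_natCast_atTop_atTop.eventually_ge_atTop t] with n h1 h2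
      exact ⟨h1, by linarith⟩
  have hz : ∀ t, ∃ x, 0 < t → Tendsto (fun n => α n t) atTop (𝓝 x) := fun t => by
    by_cases ht : 0 < t
    · have hC : CauchySeq fun n => α n t := by
        refine Metric.cauchySeq_iff'.2 fun e he => ?_
        have h1 : Tendsto (fun n : ℕ => speed v * (1 / ((n : ℝ) + 1))) atTop (𝓝 0) := by
          simpa using hlim0.const_mul (speed v)
        obtain ⟨n, hn1, hn2⟩ := ((hev t ht).and (h1.eventually_lt_const he)).exists
        exact ⟨n, fun m hm => by
          rw [dist_eq_norm]; exact (hclose n m hm t hn1).trans_lt hn2⟩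
      obtain ⟨x, hx⟩ := cauchySeq_tendsto_of_complete hC
      exact ⟨x, fun _ => hx⟩
    · exact ⟨0, fun h => absurd h ht⟩
  choose z' hz' using hz
  obtain ⟨z, hzdef⟩ : ∃ z : ℝ → Plane, z = fun t => if 0 < t then z' t else y := ⟨_, rfl⟩
  have hz0 : z 0 = y := by simp [hzdef]
  have hzt : ∀ t, 0 < t → Tendsto (fun n => α n t) atTop (𝓝 (z t)) := fun t ht => by
    simpa [hzdef, ht] using hz' t ht
  have hderiv : ∀ t, 0 < t → HasDerivAt z (drift v ε t (z t)) t := fun t ht => by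
    have hab : t / 2 ≤ t + 1 := by linarith
    have ht2 : 0 < t / 2 := by positivity
    obtain ⟨β, hβ0, hβ⟩ := exists_isDriftPath v hε ht2 hab (z (t / 2))
    -- The limit is a solution because contraction identifies it with the true path started at `z (t
    -- / 2)`.
    have heq : ∀ s ∈ Icc (t / 2) (t + 1), z s = β s := fun s hs => by
      have h1 : Tendsto (fun n => ‖α n (t / 2) - β (t / 2)‖) atTop (𝓝 0) := by
        rw [hβ0]
        exact tendsto_iff_norm_sub_tendsto_zero.1 (hzt _ ht2)
      have h2 : Tendsto (fun n => α n s) atTop (𝓝 (β s)) := by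
        rw [tendsto_iff_norm_sub_tendsto_zero]
        refine squeeze_zero' (Eventually.of_forall fun _ => norm_nonneg _) ?_ h1
        filter_upwards [hev _ ht2, hev s (ht2.trans_le hs.1)] with n hn1 hn2
        exact IsDriftPath.norm_sub_le hε ht2 hs.1 ((hα n).mono (Icc_subset_Icc hn1.1 hn2.2))
          (hβ.mono (Icc_subset_Icc_right hs.2))
      exact tendsto_nhds_unique (hzt s (ht2.trans_le hs.1)) h2
    have htI : t ∈ Ioo (t / 2) (t + 1) := ⟨by linarith, by linarith⟩
    have hd := hβ.hasDerivAt htI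
    rw [← heq t (Ioo_subset_Icc_self htI)] at hd
    exact hd.congr_of_eventuallyEq (by
      filter_upwards [Icc_mem_nhds htI.1 htI.2] with s hs using heq s hs)
  refine ⟨z, hz0, fun t ht => ?_, hderiv⟩
  rcases (mem_Ici.1 ht).eq_or_lt with rfl | ht
  · have hb : ∀ s ∈ Ici (0 : ℝ), ‖z s - z 0‖ ≤ speed v * s := fun s hs => by
      rw [hz0]
      rcases (mem_Ici.1 hs).eq_or_lt with rfl | hs
      · simp [hz0]
      · refine le_of_tendsto ((hzt s hs).sub_const y).norm ?_
        filter_upwards [hev s hs] with n hn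
        refine (hdisp n s hn).trans ?_
        gcongr
        linarith [ha0 n]
    rw [ContinuousWithinAt, tendsto_iff_norm_sub_tendsto_zero]
    refine squeeze_zero' (Eventually.of_forall fun _ => norm_nonneg _)
      (eventually_mem_nhdsWithin.mono hb) ?_
    have : ContinuousWithinAt (fun s => speed v * s) (Ici 0) 0 := by fun_prop
    simpa [ContinuousWithinAt] using this
  · exact (hderiv t ht).continuousAt.continuousWithinAt

lemma exists_isViscousFlow (v : Fin 3 → Plane) {ε : ℝ} (hε : 0 < ε) :
    ∃ Y, IsViscousFlow v ε Y := by
  choose z h0 hc hd using exists_viscous_path v hε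
  refine ⟨fun t y => z y t, fun y => ⟨h0 y, hc y, fun t ht => ?_⟩⟩
  rw [(hasGradientAt_uVisc v hε ht _).gradient]
  exact hd y t ht

/-! ### The zero-viscosity limit -/

lemma IsViscousFlow.hasDerivAt_drift {v : Fin 3 → Plane} {ε : ℝ} {Y : ℝ → Plane → Plane}
    (hε : 0 < ε) (hY : IsViscousFlow v ε Y) (y : Plane) {t : ℝ} (ht : 0 < t) :
    HasDerivAt (fun s => Y s y) (drift v ε t (Y t y)) t := by
  rw [← (hasGradientAt_uVisc v hε ht _).gradient]
  exact (hY y).2.2 t ht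

lemma IsViscousFlow.norm_sub_sq_le {v : Fin 3 → Plane} {ε δ : ℝ} {Y Z : ℝ → Plane → Plane}
    (hε : 0 < ε) (hδ : 0 < δ) (hY : IsViscousFlow v ε Y) (hZ : IsViscousFlow v δ Z) {t : ℝ}
    (ht : 0 ≤ t) (y : Plane) :
    ‖Y t y - Z t y‖ ^ 2 ≤ 2 * (ε * Real.log 3 + δ * Real.log 3) * t := by
  have h := norm_sub_sq_le_of_supergradient (α := fun s => Y s y) (β := fun s => Z s y)
    (f := uVisc v ε) (g := uVisc v δ) (A := ε * Real.log 3) (B := δ * Real.log 3) ht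
    ((hY y).2.1.mono Icc_subset_Ici_self) ((hZ y).2.1.mono Icc_subset_Ici_self)
    (fun s hs => (hY.hasDerivAt_drift hε y hs.1).hasDerivWithinAt)
    (fun s hs => (hZ.hasDerivAt_drift hδ y hs.1).hasDerivWithinAt)
    (fun s hs => drift_mem_differential v hε hs.1 _)
    (fun s hs => drift_mem_differential v hδ hs.1 _)
    (fun s hs x => by linarith [uVisc_le_u v hδ hs.1 x, u_sub_le_uVisc v hε hs.1 x])
    (fun s hs x => by linarith [uVisc_le_u v hε hs.1 x, u_sub_le_uVisc v hδ hs.1 x])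
  simpa [(hY y).1, (hZ y).1] using h

lemma IsViscousFlow.norm_sub_le {v : Fin 3 → Plane} {ε : ℝ} {Y : ℝ → Plane → Plane}
    (hε : 0 < ε) (hY : IsViscousFlow v ε Y) {s t : ℝ} (hs : 0 ≤ s) (hst : s ≤ t) (y z : Plane) :
    ‖Y t y - Y t z‖ ≤ ‖Y s y - Y s z‖ := by
  have hsub : Icc s t ⊆ Ici 0 := fun r hr => hs.trans hr.1
  have h := norm_sub_sq_le_of_supergradient (α := fun s => Y s y) (β := fun s => Y s z)
    (f := uVisc v ε) (g := uVisc v ε) (A := 0) (B := 0) hst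
    ((hY y).2.1.mono hsub) ((hY z).2.1.mono hsub)
    (fun r hr => (hY.hasDerivAt_drift hε y (hs.trans_lt hr.1)).hasDerivWithinAt)
    (fun r hr => (hY.hasDerivAt_drift hε z (hs.trans_lt hr.1)).hasDerivWithinAt)
    (fun r hr => drift_mem_differential v hε (hs.trans_lt hr.1) _)
    (fun r hr => drift_mem_differential v hε (hs.trans_lt hr.1) _)
    (fun _ _ x => by simp) (fun _ _ x => by simp)
  refine le_of_sq_le_sq ?_ (norm_nonneg _)
  linarith

lemma exists_isLagrangianFlow (v : Fin 3 → Plane) : ∃ X, IsLagrangianFlow v X := by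
  have hex : ∀ ε : ℝ, ∃ Y, 0 < ε → IsViscousFlow v ε Y := fun ε => by
    by_cases hε : 0 < ε
    · obtain ⟨Y, hY⟩ := exists_isViscousFlow v hε
      exact ⟨Y, fun _ => hY⟩
    · exact ⟨fun _ y => y, fun h => absurd h hε⟩
  choose Y hY using hex
  have hlim : ∀ t, ∀ y, ∃ x, 0 ≤ t → Tendsto (fun ε => Y ε t y) (𝓝[>] 0) (𝓝 x) := fun t y => by
    by_cases ht : 0 ≤ t
    · have hC : Cauchy (map (fun ε => Y ε t y) (𝓝[>] 0)) := by
        refine Metric.cauchy_iff.2 ⟨inferInstance, fun e he => ?_⟩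
        have hl : Tendsto (fun ε : ℝ => 4 * (ε * Real.log 3) * t) (𝓝[>] 0) (𝓝 0) := by
          have : ContinuousWithinAt (fun ε : ℝ => 4 * (ε * Real.log 3) * t) (Ioi 0) 0 := by
            fun_prop
          simpa [ContinuousWithinAt] using this
        obtain ⟨d, hd, hd0⟩ := ((hl.eventually_lt_const (by positivity : 0 < e ^ 2)).and
          self_mem_nhdsWithin).exists
        -- For ε, δ ≤ d the squared distance is at most 2(ε + δ)t log 3 ≤ 4dt log 3 < e².
        refine ⟨(fun ε => Y ε t y) '' Ioc 0 d, image_mem_map (Ioc_mem_nhdsGT hd0), ?_⟩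
        rintro _ ⟨ε, hε, rfl⟩ _ ⟨δ, hδ, rfl⟩
        rw [dist_eq_norm]
        refine lt_of_pow_lt_pow_left₀ 2 he.le ?_
        refine lt_of_le_of_lt (((hY ε hε.1).norm_sub_sq_le hε.1 hδ.1 (hY δ hδ.1) ht y).trans ?_) hd
        have hlog : 0 < Real.log 3 := Real.log_pos (by norm_num)
        have h1 := mul_le_mul_of_nonneg_right hε.2 hlog.le
        have h2 := mul_le_mul_of_nonneg_right hδ.2 hlog.le
        exact mul_le_mul_of_nonneg_right (by linarith) ht
      obtain ⟨x, hx⟩ := CompleteSpace.complete hC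
      exact ⟨x, fun _ => hx⟩
    · exact ⟨0, fun h => absurd h ht⟩
  choose X hX using hlim
  exact ⟨X, Y, hY, fun t ht y => hX t y ht⟩

/-- A trajectory of the differential inclusion `Z' ∈ ∂u_t(Z)` is one of the Lagrangian flow. -/
lemma IsLagrangianFlow.eq_of_inclusion {v : Fin 3 → Plane} {X : ℝ → Plane → Plane}
    (hX : IsLagrangianFlow v X) {y : Plane} {Z p : ℝ → Plane} (h0 : Z 0 = y)
    (hZ : ContinuousOn Z (Ici 0)) (hd : ∀ t, 0 < t → HasDerivWithinAt Z (p t) (Ici t) t)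
    (hp : ∀ t, 0 < t → p t ∈ differential 0 (u v t) (Z t)) {t : ℝ} (ht : 0 ≤ t) :
    Z t = X t y := by
  obtain ⟨Y, hY, hlim⟩ := hX
  refine tendsto_nhds_unique ?_ (hlim t ht y)
  rw [tendsto_iff_norm_sub_tendsto_zero]
  have hle : ∀ ε ∈ Ioi (0 : ℝ), ‖Y ε t y - Z t‖ ≤ Real.sqrt (2 * (ε * Real.log 3) * t) :=
    fun ε hε => by
      have hε : 0 < ε := hε
      have h := norm_sub_sq_le_of_supergradient (α := fun s => Y ε s y) (β := Z)
        (f := uVisc v ε) (g := u v) (A := ε * Real.log 3) (B := 0) ht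
        ((hY ε hε y).2.1.mono Icc_subset_Ici_self) (hZ.mono Icc_subset_Ici_self)
        (fun s hs => ((hY ε hε).hasDerivAt_drift hε y hs.1).hasDerivWithinAt)
        (fun s hs => hd s hs.1) (fun s hs => drift_mem_differential v hε hs.1 _)
        (fun s hs => hp s hs.1) (fun s hs x => u_sub_le_uVisc v hε hs.1 x)
        (fun s hs x => by simpa using uVisc_le_u v hε hs.1 x)
      exact Real.le_sqrt_of_sq_le (by simpa [(hY ε hε y).1, h0] using h)
  refine squeeze_zero' (Eventually.of_forall fun _ => norm_nonneg _)
    (eventually_mem_nhdsWithin.mono hle) ?_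
  have : ContinuousWithinAt (fun ε : ℝ => Real.sqrt (2 * (ε * Real.log 3) * t)) (Ioi 0) 0 := by
    fun_prop
  simpa [ContinuousWithinAt] using this

lemma IsLagrangianFlow.isSticky {v : Fin 3 → Plane} {X : ℝ → Plane → Plane}
    (hX : IsLagrangianFlow v X) : IsSticky X := by
  obtain ⟨Y, hY, hlim⟩ := hX
  intro s t hs hst y z h
  have hle : ‖X t y - X t z‖ ≤ ‖X s y - X s z‖ :=
    le_of_tendsto_of_tendsto (((hlim t (hs.trans hst) y).sub (hlim t (hs.trans hst) z)).norm)
      (((hlim s hs y).sub (hlim s hs z)).norm)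
      (eventually_mem_nhdsWithin.mono fun ε hε => (hY ε hε).norm_sub_le hε hs hst y z)
  rw [h, sub_self, norm_zero] at hle
  exact sub_eq_zero.1 (norm_le_zero_iff.1 hle)

/-! ### The convexified transport map -/

/-- If `P` has at `R y` a strong subgradient `y` for each `y`, then `R` is the gradient of the
Legendre transform of `P`. -/
lemma hasGradientAt_legendre {P : Plane → ℝ} {R : Plane → Plane}
    (h : ∀ y z, P (R y) + inner ℝ y (z - R y) + ‖z - R y‖ ^ 2 / 2 ≤ P z) (y : Plane) :
    HasGradientAt (legendre P) (R y) y := by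
  have hval : ∀ y, IsLUB (range fun x => inner ℝ y x - P x) (inner ℝ y (R y) - P (R y)) := by
    refine fun y => IsGreatest.isLUB ⟨⟨R y, rfl⟩, ?_⟩
    rintro _ ⟨z, rfl⟩
    have h1 := h y z
    have h2 : 0 ≤ ‖z - R y‖ ^ 2 / 2 := by positivity
    rw [inner_sub_right] at h1
    simp only
    linarith
  have hleg : ∀ y, legendre P y = inner ℝ y (R y) - P (R y) := fun y => (hval y).csSup_eq
    (range_nonempty _)
  -- Adding the two strong subgradient inequalities gives |Ry - Rz|² ≤ (y - z) · (Ry - Rz). So R is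
  -- a continuous selection of subgradients of the transform.
  have hlip : LipschitzWith 1 R := LipschitzWith.of_dist_le_mul fun y z => by
    rw [dist_eq_norm, dist_eq_norm, NNReal.coe_one, one_mul]
    have h1 := h y (R z)
    have h2 := h z (R y)
    have h3 : inner ℝ (y - z) (R y - R z) ≤ ‖y - z‖ * ‖R y - R z‖ := real_inner_le_norm _ _
    rw [norm_sub_rev (R z)] at h1
    rw [inner_sub_left, inner_sub_right, inner_sub_right] at h3
    rw [inner_sub_right] at h1 h2
    have h4 : ‖R y - R z‖ * ‖R y - R z‖ ≤ ‖y - z‖ * ‖R y - R z‖ := by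
      rw [← sq]; linarith
    rcases (norm_nonneg (R y - R z)).eq_or_lt with h5 | h5
    · rw [← h5]; positivity
    · exact le_of_mul_le_mul_right h4 h5
  have hneg : HasGradientAt (fun y => -legendre P y) (-R y) y := by
    refine hasGradientAt_of_supergradient (q := fun y => -R y) (fun x z => ?_)
      hlip.continuous.neg.continuousAt
    have h1 := (hval z).1 ⟨R x, rfl⟩
    simp only at h1
    rw [hleg x, hleg z, inner_neg_left, inner_sub_right, real_inner_comm z, real_inner_comm x]
    linarith
  rw [hasGradientAt_iff_hasFDerivAt] at hneg ⊢
  simpa using hneg.fun_neg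

/-- The optimality condition for the velocity `q` of `T_t y = y + t q`. -/
def IsOptimal (v : Fin 3 → Plane) (c : Plane) (t : ℝ) (y q : Plane) : Prop :=
  q ∈ convexHull ℝ (range v) ∧
    ∀ k ∈ convexHull ℝ (range v), 0 ≤ t * inner ℝ (y + t • (q - c)) (k - q)

/-- For t > 0 the optimal q is the projection of c - y/t onto the triangle. At t = 0 the factor t
makes the condition void and any point serves. -/
lemma exists_isOptimal (v : Fin 3 → Plane) (c : Plane) {t : ℝ} (ht : 0 ≤ t) (y : Plane) :
    ∃ q, IsOptimal v c t y q := by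
  rcases ht.eq_or_lt with rfl | ht
  · exact ⟨v 0, vertex_mem v 0, fun k _ => by simp⟩
  obtain ⟨q, hq, h⟩ := exists_projection v (c - t⁻¹ • y)
  refine ⟨q, hq, fun k hk => ?_⟩
  have h1 : y + t • (q - c) = t • (q - (c - t⁻¹ • y)) := by
    rw [smul_sub, smul_sub, smul_sub, smul_inv_smul₀ ht.ne']; abel
  rw [h1, real_inner_smul_left]
  have := h k hk
  positivity

lemma IsOptimal.mul_inner_eq {v : Fin 3 → Plane} {c : Plane} {t : ℝ} {y q : Plane} (ht : 0 ≤ t)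
    (h : IsOptimal v c t y q) :
    t * inner ℝ q (y + t • (q - c)) = t * phi v (y + t • (q - c)) := by
  obtain ⟨i, hi⟩ := exists_phi_eq v (y + t • (q - c))
  have h1 := h.2 _ (vertex_mem v i)
  rw [real_inner_comm, inner_sub_left, ← hi, mul_sub] at h1
  refine le_antisymm (by linarith) (mul_le_mul_of_nonneg_left (phi_le_inner h.1 _) ht)

lemma IsOptimal.inner_eq {v : Fin 3 → Plane} {c : Plane} {t : ℝ} {y q : Plane} (ht : 0 < t)
    (h : IsOptimal v c t y q) : inner ℝ q (y + t • (q - c)) = phi v (y + t • (q - c)) :=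
  mul_left_cancel₀ ht.ne' (h.mul_inner_eq ht.le)

lemma legendre_psi {v : Fin 3 → Plane} {c : Plane} (hc : ∀ i j, ‖v i - c‖ = ‖v j - c‖) {t : ℝ}
    (ht : 0 ≤ t) (x : Plane) : legendre (psi v t) x =
      ‖x‖ ^ 2 / 2 - t * phi v (x - t • c) - t * (t * ((‖c‖ ^ 2 - ‖v 0 - c‖ ^ 2) / 2)) := by
  have hk := inner_sub_smul_center hc t x
  have hsq : ∀ y a : Plane, inner ℝ x y - (‖y‖ ^ 2 / 2 + t * inner ℝ a y) =
      ‖x‖ ^ 2 / 2 - t * (inner ℝ a x - t / 2 * ‖a‖ ^ 2) - ‖y - x + t • a‖ ^ 2 / 2 := fun y a => by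
    rw [sq_norm_add_smul, norm_sub_sq_real, inner_sub_right, real_inner_comm x y]
    ring
  have hle : ∀ y, inner ℝ x y - psi v t y ≤
      ‖x‖ ^ 2 / 2 - t * phi v (x - t • c) - t * (t * ((‖c‖ ^ 2 - ‖v 0 - c‖ ^ 2) / 2)) := fun y => by
    obtain ⟨j, hj⟩ := exists_phi_eq v y
    have h2 := hsq y (v j)
    rw [hk] at h2
    have h3 := mul_le_mul_of_nonneg_left (phi_le v (x - t • c) j) ht
    have h4 : 0 ≤ ‖y - x + t • v j‖ ^ 2 / 2 := by positivity
    rw [psi, hj]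
    linarith
  refine IsLUB.csSup_eq (IsGreatest.isLUB ⟨?_, ?_⟩) (range_nonempty _)
  · obtain ⟨i, hi⟩ := exists_phi_eq v (x - t • c)
    have h1 := hsq (x - t • v i) (v i)
    rw [sub_sub_cancel_left, neg_add_cancel, hk, ← hi, norm_zero] at h1
    refine ⟨x - t • v i, le_antisymm (hle _) ?_⟩
    have h2 := mul_le_mul_of_nonneg_left (phi_le v (x - t • v i) i) ht
    simp only [psi]
    linarith
  · rintro _ ⟨y, rfl⟩
    exact hle y

/-- By `legendre_psi` the transform of ψ_t is |x|²/2 minus t times a concave function, hence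
strongly convex; optimality of q says that y is a strong subgradient of it at y + tq. -/
lemma T_eq {v : Fin 3 → Plane} {c : Plane} (hc : ∀ i j, ‖v i - c‖ = ‖v j - c‖) {t : ℝ}
    (ht : 0 ≤ t) {y q : Plane} (hq : IsOptimal v c t y q) : T v t y = y + t • q := by
  have hex : ∃ r : Plane → Plane, (∀ y, IsOptimal v c t y (r y)) ∧ r y = q := by
    choose r hr using exists_isOptimal v c ht
    refine ⟨Function.update r y q, fun z => ?_, Function.update_self ..⟩
    rcases eq_or_ne z y with rfl | h
    · rwa [Function.update_self]
    · rw [Function.update_of_ne h]; exact hr z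
  obtain ⟨r, hr, rfl⟩ := hex
  refine (hasGradientAt_legendre (R := fun y => y + t • r y) (fun y z => ?_) y).gradient
  obtain ⟨x, hx⟩ : ∃ x, x = y + t • r y := ⟨_, rfl⟩
  have hw : y + t • (r y - c) = x - t • c := by rw [hx, smul_sub]; abel
  have h1 := (hr y).mul_inner_eq ht
  have h2 := mul_le_mul_of_nonneg_left (phi_le_inner (hr y).1 (z - t • c)) ht
  rw [hw] at h1
  have h3 : ‖z‖ ^ 2 = ‖x‖ ^ 2 + 2 * inner ℝ x (z - x) + ‖z - x‖ ^ 2 := by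
    rw [← norm_add_sq_real, add_sub_cancel]
  have h4 : inner ℝ x (z - x) = inner ℝ y (z - x) + t * inner ℝ (r y) (z - x) := by
    rw [← real_inner_smul_left, ← inner_add_left, ← hx]
  have h5 : inner ℝ (r y) (z - x) =
      inner ℝ (r y) (z - t • c) - (inner ℝ (r y) (x - t • c) : ℝ) := by
    rw [← inner_sub_right, sub_sub_sub_cancel_right]
  rw [h5] at h4
  simp only [← hx, legendre_psi hc ht]
  linarith

lemma norm_le_speed_of_mem_convexHull {v : Fin 3 → Plane} {q : Plane}
    (hq : q ∈ convexHull ℝ (range v)) : ‖q‖ ≤ speed v := by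
  have h : convexHull ℝ (range v) ⊆ Metric.closedBall 0 (speed v) := by
    refine convexHull_min ?_ (convex_closedBall _ _)
    rintro _ ⟨i, rfl⟩
    simpa using norm_le_speed v i
  simpa using h hq

/-- Provides continuity in time down to t = 0. For positive times, q and r are supergradients of φ
at points differing by t(q - r) + (t - s)(r - c), so dissipativity gives t|q - r| ≤ |t - s||r - c|.
-/
lemma norm_T_sub_T_le {v : Fin 3 → Plane} {c : Plane} (hc : ∀ i j, ‖v i - c‖ = ‖v j - c‖)
    {s t : ℝ} (hs : 0 ≤ s) (ht : 0 ≤ t) (y : Plane) :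
    ‖T v t y - T v s y‖ ≤ (2 * speed v + ‖c‖) * |t - s| := by
  obtain ⟨q, hq⟩ := exists_isOptimal v c ht y
  obtain ⟨r, hr⟩ := exists_isOptimal v c hs y
  have hqn := norm_le_speed_of_mem_convexHull hq.1
  have hrn := norm_le_speed_of_mem_convexHull hr.1
  have hS := speed_nonneg v
  have hcn := norm_nonneg c
  rw [T_eq hc ht hq, T_eq hc hs hr, add_sub_add_left_eq_sub]
  rcases hs.eq_or_lt with rfl | hs
  · rw [zero_smul, sub_zero, sub_zero, norm_smul, Real.norm_eq_abs, mul_comm]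
    gcongr
    linarith
  rcases ht.eq_or_lt with rfl | ht
  · rw [zero_smul, zero_sub, zero_sub, norm_neg, abs_neg, norm_smul, Real.norm_eq_abs, mul_comm]
    gcongr
    linarith
  have h1 := phi_le_phi_add hq.1 (hq.inner_eq ht) (y + s • (r - c))
  have h2 := phi_le_phi_add hr.1 (hr.inner_eq hs) (y + t • (q - c))
  have h3 : y + s • (r - c) - (y + t • (q - c)) = -(t • (q - r) + (t - s) • (r - c)) := by module
  have h4 : y + t • (q - c) - (y + s • (r - c)) = t • (q - r) + (t - s) • (r - c) := by module
  rw [h3, inner_neg_right] at h1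
  rw [h4] at h2
  have h5 : inner ℝ (q - r) (t • (q - r) + (t - s) • (r - c)) ≤ (0 : ℝ) := by
    rw [inner_sub_left]; linarith
  rw [inner_add_right, inner_smul_right, real_inner_self_eq_norm_sq] at h5
  have h6 : -(‖q - r‖ * ‖(t - s) • (r - c)‖) ≤ inner ℝ (q - r) ((t - s) • (r - c)) :=
    neg_le_of_abs_le (abs_real_inner_le_norm _ _)
  have h7 : ‖(t - s) • (r - c)‖ ≤ (speed v + ‖c‖) * |t - s| := by
    rw [norm_smul, Real.norm_eq_abs, mul_comm]
    gcongr
    exact (norm_sub_le _ _).trans (by gcongr)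
  have h8 : t * ‖q - r‖ ≤ (speed v + ‖c‖) * |t - s| := by
    refine le_trans ?_ h7
    rcases (norm_nonneg (q - r)).eq_or_lt with h | h
    · rw [← h, mul_zero]; positivity
    · refine le_of_mul_le_mul_right ?_ h
      linarith
  have h9 : t • q - s • r = t • (q - r) + (t - s) • r := by module
  rw [h9]
  refine (norm_add_le _ _).trans ?_
  rw [norm_smul, norm_smul, Real.norm_of_nonneg ht.le, Real.norm_eq_abs]
  have h10 := mul_le_mul_of_nonneg_left hrn (abs_nonneg (t - s))
  linarith

/-- If the circumcenter lies in the triangle, the transport map has a right derivative in the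
superdifferential of `u_t`. -/
lemma exists_hasDerivWithinAt_T {v : Fin 3 → Plane} (hv : AffineIndependent ℝ v) {c : Plane}
    (hc : ∀ i j, ‖v i - c‖ = ‖v j - c‖) (hcv : c ∈ convexHull ℝ (range v)) {t : ℝ} (ht : 0 < t)
    (y : Plane) : ∃ m ∈ differential 0 (u v t) (T v t y),
      HasDerivWithinAt (fun s => T v s y) m (Ici t) t := by
  obtain ⟨q, hq⟩ := exists_isOptimal v c ht.le y
  have hqw := hq.inner_eq ht
  obtain ⟨w, hw⟩ : ∃ w, w = y + t • (q - c) := ⟨_, rfl⟩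
  rw [← hw] at hqw
  obtain ⟨m, hm, hmw, hmk⟩ := exists_face_velocity hv hc hcv hq.1 hqw
  have hTw : T v t y - t • c = w := by rw [T_eq hc ht.le hq, hw]; module
  refine ⟨m, mem_differential_u hc ht hm (by rw [hTw, hmw]), ?_⟩
  -- Vertices on the minimizing face stay level with p, by orthogonality; for the others the strict
  -- inequality persists for s near t.
  have hpos : ∀ k, ∀ p, inner ℝ p w = phi v w →
      (inner ℝ (v k) w = phi v w → inner ℝ (m - c) (v k - p) = (0 : ℝ)) →
      ∀ᶠ s in 𝓝[≥] t, 0 ≤ (inner ℝ (w + (s - t) • (m - c)) (v k - p) : ℝ) := by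
    intro k p hp hk
    have hg : inner ℝ w (v k - p) = inner ℝ (v k) w - phi v w := by
      rw [real_inner_comm, inner_sub_left, hp]
    rcases (phi_le v w k).eq_or_lt with h | h
    · refine Eventually.of_forall fun s => ?_
      rw [inner_add_left, real_inner_smul_left, hk h.symm, hg, h]
      simp
    · have hcont : ContinuousAt
          (fun s : ℝ => (inner ℝ (w + (s - t) • (m - c)) (v k - p) : ℝ)) t := by fun_prop
      have h0 : 0 < (inner ℝ (w + (t - t) • (m - c)) (v k - p) : ℝ) := by
        rw [sub_self, zero_smul, add_zero, hg]; linarith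
      exact ((hcont.eventually_const_lt h0).mono fun s hs => hs.le).filter_mono
        nhdsWithin_le_nhds
  have hev : ∀ᶠ s in 𝓝[≥] t, T v s y = T v t y + (s - t) • m := by
    filter_upwards [eventually_all.2 fun k => hpos k q hqw fun h => (hmk k h).1,
      eventually_all.2 fun k => hpos k m hmw fun h => (hmk k h).2, self_mem_nhdsWithin]
      with s h1 h2 hs
    have hs : t ≤ s := hs
    have hs0 : 0 < s := ht.trans_le hs
    -- Chosen so that y + sp is the straight motion from y + tq with velocity m.
    obtain ⟨p, hp⟩ : ∃ p, p = (t / s) • q + ((s - t) / s) • m := ⟨_, rfl⟩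
    have hsp : s • p = t • q + (s - t) • m := by
      rw [hp, smul_add, smul_smul, smul_smul, mul_div_cancel₀ _ hs0.ne',
        mul_div_cancel₀ _ hs0.ne']
    have hws : y + s • (p - c) = w + (s - t) • (m - c) := by
      rw [smul_sub, hsp, hw]; module
    have hpv : p ∈ convexHull ℝ (range v) := by
      rw [hp]
      refine convex_convexHull ℝ _ hq.1 hm (by positivity)
        (div_nonneg (sub_nonneg.2 hs) hs0.le) ?_
      field_simp
      ring
    have hopt : IsOptimal v c s y p := by
      refine ⟨hpv, fun k hk => mul_nonneg hs0.le ?_⟩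
      rw [hws, real_inner_comm, inner_sub_left, sub_nonneg]
      refine le_inner_of_mem_convexHull hk fun i => ?_
      rw [hp, inner_add_left, real_inner_smul_left, real_inner_smul_left]
      have h3 := h1 i
      have h4 := h2 i
      rw [real_inner_comm, inner_sub_left, sub_nonneg] at h3 h4
      have h5 := mul_le_mul_of_nonneg_left h3 (by positivity : 0 ≤ t / s)
      have h6 := mul_le_mul_of_nonneg_left h4 (div_nonneg (sub_nonneg.2 hs) hs0.le)
      have h7 : t / s + (s - t) / s = 1 := by field_simp; ring
      refine (add_le_add h5 h6).trans (le_of_eq ?_)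
      rw [← add_mul, h7, one_mul]
    rw [T_eq hc hs0.le hopt, T_eq hc ht.le hq, hsp]
    abel
  have hd : HasDerivWithinAt (fun s : ℝ => T v t y + (s - t) • m) m (Ici t) t := by
    simpa using ((((hasDerivAt_id t).sub_const t).smul_const m).const_add
      (T v t y)).hasDerivWithinAt
  exact hd.congr_of_eventuallyEq hev (by simp)

lemma T_eq_of_mem_convexHull {v : Fin 3 → Plane} (hv : AffineIndependent ℝ v) {c : Plane}
    (hc : ∀ i j, ‖v i - c‖ = ‖v j - c‖) (hcv : c ∈ convexHull ℝ (range v))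
    {X : ℝ → Plane → Plane} (hX : IsLagrangianFlow v X) {t : ℝ} (ht : 0 ≤ t) (y : Plane) :
    T v t y = X t y := by
  have hex : ∀ s, ∃ m, 0 < s → m ∈ differential 0 (u v s) (T v s y) ∧
      HasDerivWithinAt (fun s => T v s y) m (Ici s) s := fun s => by
    by_cases hs : 0 < s
    · obtain ⟨m, h1, h2⟩ := exists_hasDerivWithinAt_T hv hc hcv hs y
      exact ⟨m, fun _ => ⟨h1, h2⟩⟩
    · exact ⟨0, fun h => absurd h hs⟩
  choose p hp using hex
  obtain ⟨q, hq⟩ := exists_isOptimal v c le_rfl y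
  refine hX.eq_of_inclusion (Z := fun s => T v s y) (p := p) ?_ (fun s hs => ?_)
    (fun s hs => (hp s hs).2) (fun s hs => (hp s hs).1) ht
  · simp [T_eq hc le_rfl hq]
  · rw [ContinuousWithinAt, tendsto_iff_norm_sub_tendsto_zero]
    refine squeeze_zero' (Eventually.of_forall fun _ => norm_nonneg _)
      (eventually_mem_nhdsWithin.mono fun r hr => norm_T_sub_T_le hc hs hr y) ?_
    have : ContinuousWithinAt (fun r : ℝ => (2 * speed v + ‖c‖) * |r - s|) (Ici 0) s := by
      fun_prop
    simpa [ContinuousWithinAt] using this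

/-- If the transport maps are sticky, the circumcenter lies in the triangle: otherwise the points
that meet at `c` at time one, among them the one whose velocity is closest to `c`, separate. -/
lemma mem_convexHull_of_isSticky {v : Fin 3 → Plane} (hv : AffineIndependent ℝ v) {c : Plane}
    (hc : ∀ i j, ‖v i - c‖ = ‖v j - c‖) (h : IsSticky (T v)) : c ∈ convexHull ℝ (range v) := by
  obtain ⟨q, hq, hqk⟩ := exists_projection v c
  -- Here w = (c - p) + (p - c) = 0, so optimality is trivial.
  have h1 : ∀ p ∈ convexHull ℝ (range v), T v 1 (c - p) = c := fun p hp => by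
    have ho : IsOptimal v c 1 (c - p) p := ⟨hp, fun k _ => by simp⟩
    rw [T_eq hc zero_le_one ho]
    module
  have h2 : T v 2 (c - q) = c + q := by
    have ho : IsOptimal v c 2 (c - q) q := ⟨hq, fun k hk => by
      have : c - q + (2 : ℝ) • (q - c) = q - c := by module
      rw [this]
      exact mul_nonneg zero_le_two (hqk k hk)⟩
    rw [T_eq hc zero_le_two ho]
    module
  -- Stickiness makes w = q - c at time two also for the path from c - v_i, with optimal p = (q +
  -- v_i)/2. Testing p against q bounds v_i · (q - c) above; the projection inequality bounds it
  -- below.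
  have h3 : ∀ i, inner ℝ (v i) (q - c) = (inner ℝ q (q - c) : ℝ) := fun i => by
    obtain ⟨p, hp⟩ := exists_isOptimal v c zero_le_two (c - v i)
    have h4 := h 1 2 zero_le_one one_le_two (c - v i) (c - q)
      (by rw [h1 _ (vertex_mem v i), h1 _ hq])
    rw [h2, T_eq hc zero_le_two hp] at h4
    have h5 : (2 : ℝ) • p = q + v i := by
      have : (2 : ℝ) • p = (c - v i + (2 : ℝ) • p) - c + v i := by abel
      rw [this, h4]; abel
    have h6 : c - v i + (2 : ℝ) • (p - c) = q - c := by
      rw [smul_sub, h5]; module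
    have h7 : q - p = (2⁻¹ : ℝ) • (q - v i) := by
      have : p = (2⁻¹ : ℝ) • (q + v i) := by rw [← h5, smul_smul]; norm_num
      rw [this]; module
    have h8 := hp.2 q hq
    rw [h6, h7, inner_smul_right, real_inner_comm, inner_sub_left] at h8
    have h9 := hqk _ (vertex_mem v i)
    rw [real_inner_comm, inner_sub_left] at h9
    linarith
  have h4 := eq_zero_of_inner_eq hv (w := q - c) fun i => by rw [h3 i, h3 0]
  rw [sub_eq_zero] at h4
  exact h4 ▸ hq

/-! ### The transport velocity -/

lemma mem_sector_iff {v : Fin 3 → Plane} {c : Plane} (hc : ∀ i j, ‖v i - c‖ = ‖v j - c‖) {t : ℝ}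
    (ht : 0 < t) {x : Plane} {i : Fin 3} : x ∈ sector v t i ↔
      ∀ j, j ≠ i → inner ℝ (v i) (x - t • c) < (inner ℝ (v j) (x - t • c) : ℝ) := by
  have h : ∀ j, ‖x - t • v j‖ ^ 2 = ‖x‖ ^ 2 - 2 * t * (inner ℝ (v j) (x - t • c) +
      t * ((‖c‖ ^ 2 - ‖v 0 - c‖ ^ 2) / 2)) := fun j => by
    rw [← inner_sub_smul_center hc, sub_eq_add_neg x, ← smul_neg, sq_norm_add_smul,
      inner_neg_left, norm_neg]
    ring
  refine forall₂_congr fun j _ => ?_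
  rw [h, h, sub_lt_sub_iff_left, mul_lt_mul_iff_right₀ (by positivity), add_lt_add_iff_right]

lemma ray_symm (v : Fin 3 → Plane) (i j : Fin 3) : ray v i j = ray v j i := by
  ext y
  constructor <;> exact fun h => ⟨h.1.symm, fun k h1 h2 => h.1 ▸ h.2 k h2 h1⟩

lemma midpoint_mem_face {v : Fin 3 → Plane} {i j : Fin 3} {w : Plane} (h : w ∈ ray v i j) :
    midpoint ℝ (v i) (v j) ∈ convexHull ℝ (range v) ∧
      inner ℝ (midpoint ℝ (v i) (v j)) w = phi v w := by
  refine ⟨(convex_convexHull ℝ _).midpoint_mem (vertex_mem v i) (vertex_mem v j), ?_⟩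
  rw [phi_eq_of_forall_le (i := i), midpoint_eq_smul_add, invOf_eq_inv, real_inner_smul_left,
    inner_add_left, ← h.1]
  · ring
  · intro k
    rcases eq_or_ne k i with rfl | h1
    · rfl
    rcases eq_or_ne k j with rfl | h2
    · exact h.1.le
    · exact (h.2 k h1 h2).le

lemma V_cases {v : Fin 3 → Plane} (hv : AffineIndependent ℝ v) {c : Plane}
    (hc : ∀ i j, ‖v i - c‖ = ‖v j - c‖) {t : ℝ} (ht : 0 < t) (x : Plane) :
    (x = t • c ∧ V v c t x = c) ∨ (V v c t x ∈ convexHull ℝ (range v) ∧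
      inner ℝ (V v c t x) (x - t • c) = phi v (x - t • c)) := by
  have hsec : ∀ i, x ∈ sector v t i → v i ∈ convexHull ℝ (range v) ∧
      inner ℝ (v i) (x - t • c) = phi v (x - t • c) := fun i hi => by
    refine ⟨vertex_mem v i, (phi_eq_of_forall_le fun j => ?_).symm⟩
    rcases eq_or_ne j i with rfl | h
    · rfl
    · exact ((mem_sector_iff hc ht).1 hi j h).le
  unfold V
  split_ifs with h0 h1 h2 h01 h12 h20
  · exact Or.inr (hsec 0 h0)
  · exact Or.inr (hsec 1 h1)
  · exact Or.inr (hsec 2 h2)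
  · exact Or.inr (midpoint_mem_face h01)
  · exact Or.inr (midpoint_mem_face h12)
  · exact Or.inr (midpoint_mem_face h20)
  refine Or.inl ⟨?_, rfl⟩
  rcases phi_cases hv (x - t • c) with h | ⟨i, hi⟩ | ⟨i, j, hij, hr⟩
  · exact sub_eq_zero.1 h
  · rw [← mem_sector_iff hc ht] at hi
    fin_cases i <;> contradiction
  · have hr' := hr
    -- `V` tests each ray in one order of its indices only, so both orders are kept.
    rw [ray_symm] at hr'
    fin_cases i <;> fin_cases j <;> contradiction

lemma V_center {v : Fin 3 → Plane} {c : Plane} (hc : ∀ i j, ‖v i - c‖ = ‖v j - c‖) {t : ℝ}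
    (ht : 0 < t) : V v c t (t • c) = c := by
  have hsec : ∀ i, t • c ∉ sector v t i := fun i hi => by
    obtain ⟨j, hj⟩ := exists_ne i
    have := (mem_sector_iff hc ht).1 hi j hj
    simp at this
  have hray : ∀ i j k, k ≠ i → k ≠ j → t • c ∉ rayAt v c t i j := fun i j k h1 h2 h => by
    have := h.2 k h1 h2
    simp at this
  rw [V, if_neg (hsec 0), if_neg (hsec 1), if_neg (hsec 2),
    if_neg (hray 0 1 2 (by decide) (by decide)), if_neg (hray 1 2 0 (by decide) (by decide)),
    if_neg (hray 2 0 1 (by decide) (by decide))]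

lemma V_mem_differential {v : Fin 3 → Plane} (hv : AffineIndependent ℝ v) {c : Plane}
    (hc : ∀ i j, ‖v i - c‖ = ‖v j - c‖) (hcv : c ∈ convexHull ℝ (range v)) {t : ℝ} (ht : 0 < t)
    (x : Plane) : V v c t x ∈ differential 0 (u v t) x := by
  rcases V_cases hv hc ht x with ⟨rfl, h⟩ | ⟨h1, h2⟩
  · rw [h]
    exact mem_differential_u hc ht hcv (by simp [phi_zero])
  · exact mem_differential_u hc ht h1 h2

lemma oneSidedLipschitz_of_mem_differential {W : Plane → Plane} {f : Plane → ℝ}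
    (h : ∀ x, W x ∈ differential 0 f x) : OneSidedLipschitz W := by
  refine ⟨0, le_rfl, fun x z => ?_⟩
  simpa using inner_supergradient_sub_le (h x) (h z) (a := 0) (b := 0) (by simp) (by simp)

/-- Between tc + ry and tc the left side is r(φ(y) - c · y), linear in r, while the bound is
quadratic in r. -/
lemma mem_convexHull_of_oneSidedLipschitz {v : Fin 3 → Plane} (hv : AffineIndependent ℝ v)
    {c : Plane} (hc : ∀ i j, ‖v i - c‖ = ‖v j - c‖) {t : ℝ} (ht : 0 < t)
    (h : OneSidedLipschitz (V v c t)) : c ∈ convexHull ℝ (range v) := by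
  obtain ⟨l, hl, h⟩ := h
  refine mem_convexHull_of_phi_le fun y => ?_
  have h1 : ∀ r ∈ Ioi (0 : ℝ), phi v y - inner ℝ c y ≤ l * r * ‖y‖ ^ 2 := fun r hr => by
    have hr : 0 < r := hr
    have h2 := h (t • c + r • y) (t • c)
    have h3 : inner ℝ (V v c t (t • c + r • y)) (r • y) = phi v (r • y) := by
      rcases V_cases hv hc ht (t • c + r • y) with ⟨h4, -⟩ | ⟨-, h4⟩
      · rw [add_eq_left] at h4
        rw [h4, inner_zero_right, phi_zero]
      · rwa [add_sub_cancel_left] at h4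
    rw [V_center hc ht, add_sub_cancel_left, inner_sub_left, h3, phi_smul v hr.le,
      inner_smul_right, norm_smul, Real.norm_of_nonneg hr.le] at h2
    refine le_of_mul_le_mul_left ?_ hr
    linarith
  have h2 : Tendsto (fun r : ℝ => l * r * ‖y‖ ^ 2) (𝓝[>] 0) (𝓝 0) := by
    have : ContinuousWithinAt (fun r : ℝ => l * r * ‖y‖ ^ 2) (Ioi 0) 0 := by fun_prop
    simpa [ContinuousWithinAt] using this
  have := ge_of_tendsto h2 (eventually_mem_nhdsWithin.mono h1)
  linarith

lemma norm_sub_center_eq (v : Fin 3 → Plane) (hv : AffineIndependent ℝ v) (i j : Fin 3) :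
    ‖v i - center v hv‖ = ‖v j - center v hv‖ := by
  have h := (⟨v, hv⟩ : Affine.Simplex ℝ Plane 2).dist_circumcenter_eq_circumradius
  rw [← dist_eq_norm, ← dist_eq_norm]
  exact (h i).trans (h j).symm

end ThreeSector

theorem proposition6 (v : Fin 3 → ThreeSector.Plane) (hv : AffineIndependent ℝ v) :
    (∃ X : ℝ → ThreeSector.Plane → ThreeSector.Plane, ThreeSector.IsLagrangianFlow v X) ∧
    ∀ X : ℝ → ThreeSector.Plane → ThreeSector.Plane, ThreeSector.IsLagrangianFlow v X →
      List.TFAE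
        [ThreeSector.center v hv ∈ convexHull ℝ (Set.range v),
          ∀ t : ℝ, 0 < t → ∀ x : ThreeSector.Plane,
            ThreeSector.V v (ThreeSector.center v hv) t x ∈
              ThreeSector.differential 0 (ThreeSector.u v t) x,
          ∀ t : ℝ, 0 ≤ t → ∀ y : ThreeSector.Plane, ThreeSector.T v t y = X t y,
          ThreeSector.IsSticky (ThreeSector.T v),
          ∀ t : ℝ, 0 < t →
            ThreeSector.OneSidedLipschitz (ThreeSector.V v (ThreeSector.center v hv) t)] := by
  have hc := ThreeSector.norm_sub_center_eq v hv
  refine ⟨ThreeSector.exists_isLagrangianFlow v, fun X hX => ?_⟩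
  tfae_have 1 → 2 := fun h t ht => ThreeSector.V_mem_differential hv hc h ht
  tfae_have 2 → 5 := fun h t ht => ThreeSector.oneSidedLipschitz_of_mem_differential (h t ht)
  tfae_have 5 → 1 := fun h =>
    ThreeSector.mem_convexHull_of_oneSidedLipschitz hv hc one_pos (h 1 one_pos)
  tfae_have 1 → 3 := fun h t ht => ThreeSector.T_eq_of_mem_convexHull hv hc h hX ht
  tfae_have 3 → 4 := fun h s t hs hst y z hyz => by
    rw [h s hs, h s hs] at hyz
    rw [h t (hs.trans hst), h t (hs.trans hst)]
    exact hX.isSticky s t hs hst y z hyz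
  tfae_have 4 → 1 := ThreeSector.mem_convexHull_of_isSticky hv hc
  tfae_finish
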